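/- **Theorem.** Over $\mathsf{ZF}$ (Zermelo–Fraenkel set theory without the axiom of choice) the following two statements are equivalent; that is, in every model of $\mathsf{ZF}$ one of them holds if and only if the other one does. 1. (Banach–Alaoglu) For every real normed space $X$, the closed unit ball of the continuous dual $X^*$ is compact in the weak-$*$ topology: every cover of it by weak-$*$ open sets has a finite subcover. 2. ($\mathsf{BPI}$, the Boolean Prime Ideal theorem) For every set $X$ and every collection $\mathcal D$ of subsets of $X$ with the finite intersection property (every finite subcollection of $\mathcal D$ has non-empty intersection, where the intersection of the empty subcollection is $X$) there is a two-valued measure $\mu$ on the power set $\mathcal P(X)$, i.e. a finitely additive $\mu\colon\mathcal P(X)\to\{0,1\}$ with $\mu(X)=1$, such that $\mu(A)>0$ for all $A\in\mathcal D$. -/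

import Mathlib

/-!
# Models of Zermelo-Fraenkel set theory

The theory `ZF` is a first-order theory in the language with one binary relation symbol, and
"`ZF` proves `σ`" is rendered as "`σ` holds in every model of `ZF`". A model is a type `M` with a
binary relation `∈ₘ`. It need not be well-founded, transitive or standard, and it need not satisfy
the axiom of choice. All the notions below (finite sets, functions, the real line, normed
spaces, functionals, families of open sets, ...) are those of the model. The elements `a : M` are
its sets, `Elt a` is the type of its members, and a function or relation between such types only
counts if the model has its graph (`Internal`, `Internal₂`, `InternalRel`, `InternalSet`). So each
quantifier over functions, operations or sets amounts to a quantifier over elements of `M`.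
-/

universe u

namespace ZFModel

/-- The relation symbols of the language of set theory: a single binary one. -/
inductive MemSymb : ℕ → Type
  | mem : MemSymb 2

/-- The first-order language of set theory. -/
def setLang : FirstOrder.Language.{0, 0} := ⟨fun _ => Empty, MemSymb⟩

variable {M : Type u} [setLang.Structure M]

/-- The membership relation of a structure for the language of set theory. -/
def Mem (x y : M) : Prop :=
  FirstOrder.Language.Structure.RelMap (L := setLang) MemSymb.mem ![x, y]

infix:50 " ∈ₘ " => Mem

/-- The axioms of `ZF`. In the schemas of separation and replacement, `Set.univ.Definable` says
"defined by a first-order formula of the language of set theory, with parameters". -/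
class IsZFModel (M : Type u) [setLang.Structure M] : Prop where
  extensionality : ∀ x y : M, (∀ z, z ∈ₘ x ↔ z ∈ₘ y) → x = y
  foundation : ∀ x : M, (∃ y, y ∈ₘ x) → ∃ y, y ∈ₘ x ∧ ∀ z, z ∈ₘ x → ¬ z ∈ₘ y
  pairing : ∀ x y : M, ∃ p, ∀ z, z ∈ₘ p ↔ z = x ∨ z = y
  union : ∀ x : M, ∃ v, ∀ z, z ∈ₘ v ↔ ∃ y, y ∈ₘ x ∧ z ∈ₘ y
  power : ∀ x : M, ∃ p, ∀ z, z ∈ₘ p ↔ ∀ t, t ∈ₘ z → t ∈ₘ x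
  infinity : ∃ w : M, (∃ e, e ∈ₘ w ∧ ∀ z, ¬ z ∈ₘ e) ∧
    ∀ x, x ∈ₘ w → ∃ s, s ∈ₘ w ∧ ∀ z, z ∈ₘ s ↔ z ∈ₘ x ∨ z = x
  separation : ∀ P : Set M, (Set.univ : Set M).Definable₁ setLang P →
    ∀ a : M, ∃ b, ∀ z, z ∈ₘ b ↔ z ∈ₘ a ∧ z ∈ P
  replacement : ∀ F : Set (M × M), (Set.univ : Set M).Definable₂ setLang F →
    ∀ a : M, (∀ x, x ∈ₘ a → ∃! y, (x, y) ∈ F) →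
      ∃ b, ∀ y, y ∈ₘ b ↔ ∃ x, x ∈ₘ a ∧ (x, y) ∈ F

/-! ### Sets, pairs, functions and finite sets of the model -/

/-- The type of the members of `a`. -/
def Elt (a : M) : Type u := {x : M // x ∈ₘ a}

/-- `a` is a subset of `b`. -/
def Sub (a b : M) : Prop := ∀ z, z ∈ₘ a → z ∈ₘ b

/-- `p` is the (Kuratowski) ordered pair `{{x}, {x, y}}`. -/
def IsOPair (p x y : M) : Prop :=
  ∀ z, z ∈ₘ p ↔ (∀ t, t ∈ₘ z ↔ t = x) ∨ (∀ t, t ∈ₘ z ↔ t = x ∨ t = y)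

/-- `g` is the graph of `f : a → b`. -/
def IsGraph {a b : M} (g : M) (f : Elt a → Elt b) : Prop :=
  ∀ p, p ∈ₘ g ↔ ∃ x : Elt a, IsOPair p x.1 (f x).1

/-- `f : a → b` is a function of the model. -/
def Internal {a b : M} (f : Elt a → Elt b) : Prop := ∃ g : M, IsGraph g f

/-- `f : a × b → c` is a function of the model. -/
def Internal₂ {a b c : M} (f : Elt a → Elt b → Elt c) : Prop :=
  ∃ g : M, ∀ p, p ∈ₘ g ↔ ∃ (x : Elt a) (y : Elt b) (q : M),
    IsOPair q x.1 y.1 ∧ IsOPair p q (f x y).1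

/-- `r` is a binary relation on `a` in the model. -/
def InternalRel {a : M} (r : Elt a → Elt a → Prop) : Prop :=
  ∃ g : M, ∀ p, p ∈ₘ g ↔ ∃ x y : Elt a, IsOPair p x.1 y.1 ∧ r x y

/-- `S` is a subset of `a` in the model. -/
def InternalSet {a : M} (S : Set (Elt a)) : Prop :=
  ∃ b : M, ∀ x : M, x ∈ₘ b ↔ ∃ h : x ∈ₘ a, (⟨x, h⟩ : Elt a) ∈ S

/-- `x` is finite in the sense of the model: `x` lies in every family `F` that contains the empty
set and that contains `y ∪ {z}` whenever `y` is in `F` and `z` is in `x`. -/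
def IsFin (x : M) : Prop :=
  ∀ F : M, (∀ e, (∀ t, ¬ t ∈ₘ e) → e ∈ₘ F) →
    (∀ y z w, y ∈ₘ F → z ∈ₘ x → (∀ t, t ∈ₘ w ↔ t ∈ₘ y ∨ t = z) → w ∈ₘ F) → x ∈ₘ F

/-! ### The Boolean Prime Ideal theorem -/

/-- `P` is the power set of `X`. -/
def IsPowerset (P X : M) : Prop := ∀ A, A ∈ₘ P ↔ Sub A X

/-- Every finite subcollection of the collection `D` of subsets of `X` has non-empty intersection
(the intersection of the empty subcollection being `X`). -/
def HasFIP (X D : M) : Prop :=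
  ∀ D' : M, IsFin D' → Sub D' D → ∃ x, x ∈ₘ X ∧ ∀ A, A ∈ₘ D' → x ∈ₘ A

/-- A two-valued measure of the model on the power set `P` of `X`: a finitely additive function
with values in `{0, 1}` that gives `X` the value `1`. A function with values in `{0, 1}` is in the
model if and only if the set of the arguments where it has the value `1` is. -/
structure IsTwoValuedMeasure (X P : M) (μ : Elt P → ℕ) : Prop where
  internal : InternalSet {A | μ A = 1}
  two_valued : ∀ A, μ A = 0 ∨ μ A = 1
  empty : ∀ A : Elt P, (∀ x, ¬ x ∈ₘ A.1) → μ A = 0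
  whole : ∀ A : Elt P, A.1 = X → μ A = 1
  additive : ∀ A B C : Elt P, (∀ x, ¬ (x ∈ₘ A.1 ∧ x ∈ₘ B.1)) →
    (∀ x, x ∈ₘ C.1 ↔ x ∈ₘ A.1 ∨ x ∈ₘ B.1) → μ C = μ A + μ B

/-- `BPI` in the model `M`: for every set `X` and every collection `D` of subsets of `X` with the
finite intersection property there is a two-valued measure on the power set of `X` that is positive
on all members of `D`. -/
def BPI (M : Type u) [setLang.Structure M] : Prop :=
  ∀ X P D : M, IsPowerset P X → Sub D P → HasFIP X D →
    ∃ μ : Elt P → ℕ, IsTwoValuedMeasure X P μ ∧ ∀ A : Elt P, A.1 ∈ₘ D → 0 < μ A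

/-! ### The Banach-Alaoglu theorem -/

/-- `R` is (a copy of) the real line of the model: a Dedekind complete ordered field. In `ZF` such
a field exists and is unique up to a unique isomorphism. -/
class RealLine (R : M) extends Field (Elt R), LinearOrder (Elt R), IsStrictOrderedRing (Elt R) where
  internal_add : Internal₂ (fun x y : Elt R => x + y)
  internal_mul : Internal₂ (fun x y : Elt R => x * y)
  internal_le : InternalRel (fun x y : Elt R => x ≤ y)
  complete : ∀ S : Set (Elt R), InternalSet S → S.Nonempty → BddAbove S → ∃ s, IsLUB S s

/-- `V` is a real normed space of the model. -/
class NSpace (R V : M) [RealLine R] extends AddCommGroup (Elt V), Module (Elt R) (Elt V) where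
  /-- the norm -/
  nrm : Elt V → Elt R
  internal_add : Internal₂ (fun v w : Elt V => v + w)
  internal_smul : Internal₂ (fun (c : Elt R) (v : Elt V) => c • v)
  internal_nrm : Internal nrm
  nrm_eq_zero : ∀ v, nrm v = 0 → v = 0
  nrm_add : ∀ v w, nrm (v + w) ≤ nrm v + nrm w
  nrm_smul : ∀ (c : Elt R) v, nrm (c • v) = |c| * nrm v

/-- The dual space `V*`: the continuous linear functionals on `V` that belong to the model. -/
structure Dual (R V : M) [RealLine R] [NSpace R V] where
  /-- the functional -/
  toFun : Elt V →ₗ[Elt R] Elt R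
  internal : Internal toFun
  continuous : ∀ (v : Elt V) (ε : Elt R), 0 < ε → ∃ δ : Elt R, 0 < δ ∧
    ∀ w : Elt V, NSpace.nrm (R := R) (w - v) < δ → |toFun w - toFun v| < ε

section Dual

variable {R V : M} [RealLine R] [NSpace R V]

/-- The functional `φ`, as an element of the model, is a member of `O`. -/
def Dual.In (φ : Dual R V) (O : M) : Prop := ∃ g, g ∈ₘ O ∧ IsGraph g φ.toFun

/-- `φ` lies in the closed unit ball of `V*`, which means that `|φ v| ≤ 1` for all `v` in the
closed unit ball of `V`. -/
def Dual.InBall (φ : Dual R V) : Prop :=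
  ∀ v : Elt V, NSpace.nrm (R := R) v ≤ 1 → |φ.toFun v| ≤ 1

end Dual

/-- `O` is a weak-* open subset of `V*`: a set of functionals which contains, with each `φ`, a
basic neighbourhood `{ψ | |ψ v - φ v| < ε for all v in s}` of it, where `s` is a finite subset of
`V` and `0 < ε`. -/
def IsWeakStarOpen (R V : M) [RealLine R] [NSpace R V] (O : M) : Prop :=
  (∀ g, g ∈ₘ O → ∃ φ : Dual R V, IsGraph g φ.toFun) ∧
  ∀ φ : Dual R V, φ.In O → ∃ (s : M) (ε : Elt R), IsFin s ∧ Sub s V ∧ 0 < ε ∧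
    ∀ ψ : Dual R V, (∀ v : Elt V, v.1 ∈ₘ s → |ψ.toFun v - φ.toFun v| < ε) → ψ.In O

/-- The closed unit ball of `V*` is compact in the weak-* topology: every cover of it by weak-*
open sets has a finite subcover. -/
def BallIsWeakStarCompact (R V : M) [RealLine R] [NSpace R V] : Prop :=
  ∀ C : M, (∀ O, O ∈ₘ C → IsWeakStarOpen R V O) →
    (∀ φ : Dual R V, φ.InBall → ∃ O, O ∈ₘ C ∧ φ.In O) →
    ∃ C' : M, IsFin C' ∧ Sub C' C ∧ ∀ φ : Dual R V, φ.InBall → ∃ O, O ∈ₘ C' ∧ φ.In O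

/-- The Banach-Alaoglu theorem in the model `M`: for every (real) normed space, the closed unit
ball of the dual space is weak-* compact. -/
def BanachAlaoglu (M : Type u) [setLang.Structure M] : Prop :=
  ∀ (R V : M) [RealLine R] [NSpace R V], BallIsWeakStarCompact R V

end ZFModel

-- Both implications are classical; the work lies in carrying them out in a model `M` that may be
-- ill-founded and lack choice. The bridge is definability. A type is `Coded` if its elements stand
-- for the elements of a definable class of `M`, and `Small` if that class is a set; `Dfn M f` says
-- that the graph of `f` is definable with parameters. `Dfn` is closed under composition, pairing,
-- connectives and quantifiers over coded types, so `fun_prop` proves most instances. Separation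
-- turns definable subsets of small types into sets of `M` (`exists_comprehension`), and a set of
-- `M` is definable with itself as parameter. Hence "in the model" means "definable" (`internal_iff`
-- and its variants), and outer choice is harmless as long as its result is shown to be definable,
-- usually because it is unique.
--
-- `BPI.banachAlaoglu`: if a cover has no finite subcover, the complements of its members in the
-- dual ball have the finite intersection property, so an ultrafilter of the model contains them
-- all. For each vector `v`, the values at `v` of functionals in the ball are bounded by the norm of
-- `v` and have a limit along the ultrafilter (`IsUltra.exists_limit`). The limits are unique, so
-- they form a functional of the model, linear and in the ball. It lies in some `O` of the cover;
-- both a basic neighbourhood inside `O` and the complement of `O` belong to the ultrafilter, which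
-- is absurd.
--
-- `BanachAlaoglu.bpi`: take the bounded real functions on `X` with the supremum norm. A functional
-- with values 0 or 1 on all indicators, and 1 on those of `X` and of the members of `D`, is the
-- required measure. Violating any one of these conditions is weak-* open. Finitely many such open
-- sets do not cover the ball, since they mention finitely many members of `D` and evaluation at a
-- common point violates nothing. By compactness all of them together do not cover it either.
--
-- The second direction needs a real line in `M` (`exists_realLine`). The natural numbers of `M`
-- form a semiring by recursion (`Omega.exists_rec`), with ordered fraction field `K`. Seen from
-- outside `K` may be non-Archimedean; `exists_completion` embeds it densely in an ordered field
-- where all cuts with arbitrarily small gaps are realised. By `lt_op_iff` the elements with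
-- definable lower cut form a subfield, which is coded by these cuts and is the real line.

universe v w x

set_option linter.unusedSectionVars false

namespace ZFModel

/-! ### Definable predicates -/

section Definable

variable {M : Type u} [setLang.Structure M] {ι κ : Type}

/-- The membership symbol. -/
def memRel : setLang.Relations 2 := MemSymb.mem

/-- A predicate of a tuple of elements of the model is definable with parameters. -/
def DefPred (P : (ι → M) → Prop) : Prop := (Set.univ : Set M).Definable setLang {v | P v}

namespace DefPred

variable {P Q : (ι → M) → Prop}

theorem congr (h : DefPred P) (e : ∀ v, Q v ↔ P v) : DefPred Q := by
  have : Q = P := funext fun v => propext (e v)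
  rwa [this]

theorem mem (i j : ι) : DefPred fun v : ι → M => v i ∈ₘ v j := by
  refine (Set.empty_definable_iff.2
    ⟨FirstOrder.Language.Relations.formula₂ memRel
      (FirstOrder.Language.Term.var i) (FirstOrder.Language.Term.var j), ?_⟩).mono
      (Set.empty_subset _)
  ext v
  change v i ∈ₘ v j ↔ FirstOrder.Language.Formula.Realize _ v
  rw [FirstOrder.Language.Formula.realize_rel₂]
  rfl

theorem eq (i j : ι) : DefPred fun v : ι → M => v i = v j := by
  refine (Set.empty_definable_iff.2
    ⟨FirstOrder.Language.Term.equal (L := setLang)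
      (FirstOrder.Language.Term.var i) (FirstOrder.Language.Term.var j), ?_⟩).mono
      (Set.empty_subset _)
  ext v
  simp [FirstOrder.Language.Formula.realize_equal]

/-- Parameters enter here, as constants of the expanded language. -/
theorem eq_const (i : ι) (c : M) : DefPred fun v : ι → M => v i = c := by
  refine ⟨FirstOrder.Language.Term.equal
      (FirstOrder.Language.Term.var i)
      ((setLang.con (⟨c, trivial⟩ : (Set.univ : Set M))).term), ?_⟩
  ext v
  simp [FirstOrder.Language.Formula.realize_equal]

theorem and (hP : DefPred P) (hQ : DefPred Q) : DefPred fun v => P v ∧ Q v :=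
  Set.Definable.inter hP hQ

theorem or (hP : DefPred P) (hQ : DefPred Q) : DefPred fun v => P v ∨ Q v :=
  Set.Definable.union hP hQ

theorem not (hP : DefPred P) : DefPred fun v => ¬ P v :=
  Set.Definable.compl hP

theorem imp (hP : DefPred P) (hQ : DefPred Q) : DefPred fun v => P v → Q v :=
  (hP.not.or hQ).congr fun _ => imp_iff_not_or

theorem iff (hP : DefPred P) (hQ : DefPred Q) : DefPred fun v => P v ↔ Q v :=
  ((hP.imp hQ).and (hQ.imp hP)).congr fun _ => iff_iff_implies_and_implies

theorem reindex (hP : DefPred P) (f : ι → κ) : DefPred fun v : κ → M => P fun i => v (f i) :=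
  Set.Definable.preimage_comp f hP

/-- `Option ι` adds a coordinate for the bound variable; the quantifier is the projection forgetting
it, and projections preserve definability in finitely many variables. -/
theorem ex [Finite ι] {P : (ι → M) → M → Prop}
    (h : DefPred fun v : Option ι → M => P (fun i => v (some i)) (v none)) :
    DefPred fun v => ∃ x, P v x := by
  have := Set.Definable.image_comp h (some : ι → Option ι)
  refine DefPred.congr this fun v => ?_
  constructor
  · rintro ⟨x, hx⟩
    exact ⟨fun i => i.elim x v, hx, rfl⟩
  · rintro ⟨g, hg, rfl⟩
    exact ⟨g none, hg⟩

theorem all [Finite ι] {P : (ι → M) → M → Prop}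
    (h : DefPred fun v : Option ι → M => P (fun i => v (some i)) (v none)) :
    DefPred fun v => ∀ x, P v x :=
  (DefPred.ex (P := fun v x => ¬ P v x) h.not).not.congr fun v => by simp

theorem isOPair [Finite ι] (i j k : ι) :
    DefPred fun v : ι → M => IsOPair (v i) (v j) (v k) := by
  unfold IsOPair
  refine all (iff (mem _ _) (or (all (iff (mem _ _) (eq _ _)))
    (all (iff (mem _ _) (or (eq _ _) (eq _ _))))))

end DefPred

end Definable

/-! ### Unordered and ordered pairs -/

section Pairs

variable {M : Type u} [setLang.Structure M] [IsZFModel M]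

theorem ext {x y : M} (h : ∀ z, z ∈ₘ x ↔ z ∈ₘ y) : x = y := IsZFModel.extensionality x y h

theorem exists_isOPair (x y : M) : ∃ p, IsOPair p x y := by
  obtain ⟨s, hs⟩ := IsZFModel.pairing x x
  obtain ⟨t, ht⟩ := IsZFModel.pairing x y
  obtain ⟨p, hp⟩ := IsZFModel.pairing s t
  refine ⟨p, fun z => ?_⟩
  rw [hp]
  refine or_congr ⟨?_, fun h => ext fun w => ?_⟩ ⟨?_, fun h => ext fun w => ?_⟩
  · rintro rfl w; simp [hs]
  · simp [h, hs]
  · rintro rfl w; simp [ht]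
  · simp [h, ht]

/-- The Kuratowski pair. -/
noncomputable def opair (x y : M) : M := (exists_isOPair x y).choose

theorem isOPair_iff {p x y : M} : IsOPair p x y ↔ p = opair x y := by
  constructor
  · intro h
    exact ext fun z => (h z).trans ((exists_isOPair x y).choose_spec z).symm
  · rintro rfl
    exact (exists_isOPair x y).choose_spec

theorem opair_inj {x y x' y' : M} : opair x y = opair x' y' ↔ x = x' ∧ y = y' := by
  refine ⟨fun h => ?_, fun h => by rw [h.1, h.2]⟩
  have h1 : IsOPair (opair x y) x y := isOPair_iff.2 rfl
  have h2 : IsOPair (opair x y) x' y' := isOPair_iff.2 h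
  obtain ⟨s, hs⟩ := IsZFModel.pairing x x
  obtain ⟨t, ht⟩ := IsZFModel.pairing x y
  obtain ⟨s', hs'⟩ := IsZFModel.pairing x' x'
  obtain ⟨t', ht'⟩ := IsZFModel.pairing x' y'
  have a1 := (h2 s).1 ((h1 s).2 (Or.inl fun w => by simp [hs]))
  have a2 := (h2 t).1 ((h1 t).2 (Or.inr fun w => by simp [ht]))
  have a3 := (h1 s').1 ((h2 s').2 (Or.inl fun w => by simp [hs']))
  have a4 := (h1 t').1 ((h2 t').2 (Or.inr fun w => by simp [ht']))
  simp only [hs, ht, hs', ht', or_self] at a1 a2 a3 a4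
  rcases a1 with a | a <;> rcases a2 with b | b <;> rcases a4 with c | c <;>
    have := a x <;> have := a x' <;> have := a y' <;> have := b x <;> have := b y <;>
    have := b x' <;> have := b y' <;> have := c x <;> have := c y <;> have := c x' <;>
    have := c y' <;> grind

/-- Two distinct elements serve as truth values. -/
theorem exists_ne : ∃ p : M × M, p.1 ≠ p.2 := by
  obtain ⟨w, ⟨e, he, he'⟩, -⟩ := IsZFModel.infinity (M := M)
  refine ⟨(w, e), fun h : w = e => he' e ?_⟩
  rwa [h] at he

end Pairs

/-! ### Coded types and definable functions -/

/-- The elements of `α` are represented by the elements of a definable class of the model. -/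
class Coded (M : Type u) [setLang.Structure M] (α : Type v) where
  /-- the element of the model that represents `a` -/
  code : α → M
  code_injective : Function.Injective code
  defPred_range : DefPred fun v : Unit → M => ∃ a, code a = v ()

export Coded (code)

section Coded

variable {M : Type u} [setLang.Structure M]

/-- The graph of `f` is definable with parameters. -/
@[fun_prop]
def Dfn (M : Type u) [setLang.Structure M] {α : Type v} {β : Type w} [Coded M α] [Coded M β]
    (f : α → β) : Prop :=
  DefPred fun v : Bool → M => ∃ a, code a = v false ∧ code (f a) = v true

theorem DefPred.range_at (α : Type v) [Coded M α] {ι : Type} (i : ι) :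
    DefPred fun v : ι → M => ∃ a : α, code a = v i :=
  (Coded.defPred_range (M := M) (α := α)).reindex fun _ => i

instance : Coded M M where
  code := id
  code_injective := Function.injective_id
  defPred_range := (DefPred.eq () ()).congr fun v => by simp

variable [IsZFModel M]

/-- With coded truth values, predicates are a special case of functions, and a single calculus of
`Dfn` covers terms and formulas. -/
noncomputable instance : Coded M Prop := by
  classical
  exact
  { code := fun p => if p then exists_ne.choose.1 else exists_ne.choose.2
    code_injective := fun p q h => by
      have := (exists_ne (M := M)).choose_spec
      by_cases hp : p <;> by_cases hq : q <;> simp_all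
    defPred_range := ((DefPred.eq_const () exists_ne.choose.1).or
      (DefPred.eq_const () exists_ne.choose.2)).congr fun v => by
        constructor
        · rintro ⟨a, ha⟩
          by_cases h : a <;> simp_all
        · rintro (h | h)
          · exact ⟨True, by simp [h]⟩
          · exact ⟨False, by simp [h]⟩ }

noncomputable instance {α : Type v} {β : Type w} [Coded M α] [Coded M β] : Coded M (α × β) where
  code p := opair (code p.1) (code p.2)
  code_injective p q h := by
    rw [opair_inj] at h
    exact Prod.ext (Coded.code_injective h.1) (Coded.code_injective h.2)
  defPred_range := by
    refine (DefPred.ex (P := fun v x => ∃ y, IsOPair (v ()) x y ∧ (∃ a : α, code a = x) ∧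
      ∃ b : β, code b = y) (DefPred.ex (((DefPred.isOPair _ _ _).and
      ((DefPred.range_at α _).and (DefPred.range_at β _)))))).congr fun v => ?_
    simp only [isOPair_iff, Prod.exists]
    constructor
    · rintro ⟨a, b, h⟩
      exact ⟨_, _, h.symm, ⟨a, rfl⟩, b, rfl⟩
    · rintro ⟨x, y, h, ⟨a, rfl⟩, b, rfl⟩
      exact ⟨a, b, h.symm⟩

theorem code_mk {α : Type v} {β : Type w} [Coded M α] [Coded M β] (a : α) (b : β) :
    (code (a, b) : M) = opair (code a) (code b) := rfl

end Coded
section Dfn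

variable {M : Type u} [setLang.Structure M] {α : Type v} {β : Type w} {γ : Type x}
  [Coded M α] [Coded M β] [Coded M γ]

theorem Dfn.at {f : α → β} (h : Dfn M f) {ι : Type} (i j : ι) :
    DefPred fun v : ι → M => ∃ a, code a = v i ∧ code (f a) = v j :=
  DefPred.reindex h fun b => cond b j i

@[fun_prop]
theorem Dfn.id : Dfn M fun a : α => a := by
  refine ((DefPred.range_at (M := M) α false).and (DefPred.eq false true)).congr fun v => ?_
  grind

@[fun_prop]
theorem Dfn.const (b : β) : Dfn M fun _ : α => b := by
  refine ((DefPred.range_at (M := M) α false).and (DefPred.eq_const true (code b))).congr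
    fun v => ?_
  grind

@[fun_prop]
theorem Dfn.comp {g : β → γ} {f : α → β} (hg : Dfn M g) (hf : Dfn M f) :
    Dfn M fun a => g (f a) := by
  refine (DefPred.ex (P := fun v y => (∃ a, code a = v false ∧ code (f a) = y) ∧
    ∃ b, code b = y ∧ code (g b) = v true) ((hf.at _ _).and (hg.at _ _))).congr fun v => ?_
  constructor
  · rintro ⟨a, ha, h⟩
    exact ⟨_, ⟨a, ha, rfl⟩, _, rfl, h⟩
  · rintro ⟨_, ⟨a, ha, rfl⟩, b, hb, h⟩
    cases Coded.code_injective hb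
    exact ⟨a, ha, h⟩

variable [IsZFModel M]

@[fun_prop]
theorem Dfn.fst : Dfn M (Prod.fst : α × β → α) := by
  refine (DefPred.ex (P := fun v y => IsOPair (v false) (v true) y ∧ (∃ a : α, code a = v true) ∧
    ∃ b : β, code b = y) ((DefPred.isOPair _ _ _).and
      ((DefPred.range_at α _).and (DefPred.range_at β _)))).congr fun v => ?_
  simp only [isOPair_iff, Prod.exists, code_mk]
  constructor
  · rintro ⟨a, b, h, h'⟩
    exact ⟨_, by rw [← h, h'], ⟨a, h'⟩, b, rfl⟩
  · rintro ⟨_, h, ⟨a, ha⟩, b, rfl⟩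
    exact ⟨a, b, by rw [h, ha], ha⟩

@[fun_prop]
theorem Dfn.snd : Dfn M (Prod.snd : α × β → β) := by
  refine (DefPred.ex (P := fun v y => IsOPair (v false) y (v true) ∧ (∃ a : α, code a = y) ∧
    ∃ b : β, code b = v true) ((DefPred.isOPair _ _ _).and
      ((DefPred.range_at α _).and (DefPred.range_at β _)))).congr fun v => ?_
  simp only [isOPair_iff, Prod.exists, code_mk]
  constructor
  · rintro ⟨a, b, h, h'⟩
    exact ⟨_, by rw [← h, h'], ⟨a, rfl⟩, b, h'⟩
  · rintro ⟨_, h, ⟨a, rfl⟩, b, hb⟩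
    exact ⟨a, b, by rw [h, hb], hb⟩

@[fun_prop]
theorem Dfn.mk {f : α → β} {g : α → γ} (hf : Dfn M f) (hg : Dfn M g) :
    Dfn M fun a => (f a, g a) := by
  refine (DefPred.ex (P := fun v x => ∃ y, IsOPair (v true) x y ∧
    (∃ a, code a = v false ∧ code (f a) = x) ∧ ∃ a, code a = v false ∧ code (g a) = y)
    (DefPred.ex ((DefPred.isOPair _ _ _).and ((hf.at _ _).and (hg.at _ _))))).congr fun v => ?_
  simp only [isOPair_iff, code_mk]
  constructor
  · rintro ⟨a, h, h'⟩
    exact ⟨_, _, h'.symm, ⟨a, h, rfl⟩, a, h, rfl⟩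
  · rintro ⟨_, _, h, ⟨a, ha, rfl⟩, b, hb, rfl⟩
    cases Coded.code_injective (ha.trans hb.symm)
    exact ⟨a, ha, h.symm⟩

theorem Dfn.fst' {f : α → β × γ} (hf : Dfn M f) : Dfn M fun a => (f a).1 := Dfn.fst.comp hf

theorem Dfn.snd' {f : α → β × γ} (hf : Dfn M f) : Dfn M fun a => (f a).2 := Dfn.snd.comp hf

attribute [fun_prop] Dfn.fst' Dfn.snd'

theorem dfn_pred_iff {P : α → Prop} :
    Dfn M P ↔ DefPred fun v : Unit → M => ∃ a, code a = v () ∧ P a := by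
  constructor
  · intro h
    refine (DefPred.ex (P := fun v y => (∃ a, code a = v () ∧ code (P a) = y) ∧ y = code True)
      ((h.at _ _).and (DefPred.eq_const _ _))).congr fun v => ?_
    constructor
    · rintro ⟨a, ha, hP⟩
      exact ⟨_, ⟨a, ha, rfl⟩, by simp [hP]⟩
    · rintro ⟨_, ⟨a, ha, rfl⟩, h⟩
      exact ⟨a, ha, by simpa using Coded.code_injective h⟩
  · intro h
    have h' : DefPred fun v : Bool → M => ∃ a, code a = v false ∧ P a := h.reindex fun _ => false
    refine (((DefPred.range_at α false).and ((h'.and (DefPred.eq_const true (code True))).or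
      (h'.not.and (DefPred.eq_const true (code False))))).congr) fun v => ?_
    constructor
    · rintro ⟨a, ha, h⟩
      refine ⟨⟨a, ha⟩, ?_⟩
      by_cases hP : P a
      · exact Or.inl ⟨⟨a, ha, hP⟩, by simpa [hP] using h.symm⟩
      · refine Or.inr ⟨?_, by simpa [hP] using h.symm⟩
        rintro ⟨b, hb, hP'⟩
        cases Coded.code_injective (ha.trans hb.symm)
        exact hP hP'
    · rintro ⟨⟨a, ha⟩, ⟨⟨b, hb, hP⟩, h⟩ | ⟨hP, h⟩⟩
      · exact ⟨b, hb, by simp [hP, h]⟩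
      · have : ¬ P a := fun h => hP ⟨a, ha, h⟩
        exact ⟨a, ha, by simp [this, h]⟩

@[fun_prop]
theorem Dfn.and {P Q : α → Prop} (hP : Dfn M P) (hQ : Dfn M Q) :
    Dfn M fun a => P a ∧ Q a := by
  rw [dfn_pred_iff] at *
  refine (DefPred.and hP hQ).congr fun v => ⟨by grind, ?_⟩
  rintro ⟨⟨a, ha, h⟩, b, hb, h'⟩
  cases Coded.code_injective (ha.trans hb.symm)
  exact ⟨a, ha, h, h'⟩

@[fun_prop]
theorem Dfn.not {P : α → Prop} (hP : Dfn M P) : Dfn M fun a => ¬ P a := by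
  rw [dfn_pred_iff] at *
  refine ((DefPred.range_at α ()).and hP.not).congr fun v => ⟨?_, by grind⟩
  rintro ⟨a, ha, h⟩
  refine ⟨⟨a, ha⟩, ?_⟩
  rintro ⟨b, hb, h'⟩
  cases Coded.code_injective (ha.trans hb.symm)
  exact h h'

theorem Dfn.pred_congr {P Q : α → Prop} (h : Dfn M P) (e : ∀ a, Q a ↔ P a) : Dfn M Q := by
  have : Q = P := funext fun a => propext (e a)
  rwa [this]

@[fun_prop]
theorem Dfn.or {P Q : α → Prop} (hP : Dfn M P) (hQ : Dfn M Q) :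
    Dfn M fun a => P a ∨ Q a :=
  (hP.not.and hQ.not).not.pred_congr fun _ => by tauto

@[fun_prop]
theorem Dfn.imp {P Q : α → Prop} (hP : Dfn M P) (hQ : Dfn M Q) :
    Dfn M fun a => P a → Q a :=
  (hP.not.or hQ).pred_congr fun _ => by tauto

@[fun_prop]
theorem Dfn.iff {P Q : α → Prop} (hP : Dfn M P) (hQ : Dfn M Q) :
    Dfn M fun a => P a ↔ Q a :=
  ((hP.imp hQ).and (hQ.imp hP)).pred_congr fun _ => by tauto

@[fun_prop]
theorem Dfn.ex {P : α → β → Prop} (hP : Dfn M fun p : α × β => P p.1 p.2) :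
    Dfn M fun a => ∃ b, P a b := by
  rw [dfn_pred_iff] at *
  have hP' := fun i : Option (Option Unit) => hP.reindex fun _ => i
  refine (DefPred.ex (P := fun v x => ∃ y, IsOPair y (v ()) x ∧
    ∃ p : α × β, code p = y ∧ P p.1 p.2)
    (DefPred.ex ((DefPred.isOPair _ _ _).and (hP' _)))).congr fun v => ?_
  simp only [isOPair_iff, Prod.exists, code_mk]
  constructor
  · rintro ⟨a, ha, b, h⟩
    exact ⟨code b, _, rfl, a, b, by rw [ha], h⟩
  · rintro ⟨_, _, rfl, a, b, h, h'⟩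
    exact ⟨a, (opair_inj.1 h).1, b, h'⟩

@[fun_prop]
theorem Dfn.all {P : α → β → Prop} (hP : Dfn M fun p : α × β => P p.1 p.2) :
    Dfn M fun a => ∀ b, P a b :=
  (Dfn.ex (P := fun a b => ¬ P a b) hP.not).not.pred_congr fun _ => by simp

@[fun_prop]
theorem Dfn.mem {f g : α → M} (hf : Dfn M f) (hg : Dfn M g) : Dfn M fun a => f a ∈ₘ g a := by
  have : Dfn M fun p : M × M => p.1 ∈ₘ p.2 := by
    rw [dfn_pred_iff]
    refine (DefPred.ex (P := fun v x => ∃ y, IsOPair (v ()) x y ∧ x ∈ₘ y)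
      (DefPred.ex ((DefPred.isOPair _ _ _).and (DefPred.mem _ _)))).congr fun v => ?_
    simp only [isOPair_iff, Prod.exists, code_mk]
    exact exists_congr fun _ => exists_congr fun _ => and_congr_left fun _ => eq_comm
  exact this.comp (hf.mk hg)

@[fun_prop]
theorem Dfn.code_fun : Dfn M (code : α → M) :=
  ((DefPred.range_at (M := M) α false).and (DefPred.eq false true)).congr fun v => by
    constructor
    · rintro ⟨a, ha, h⟩
      exact ⟨⟨a, ha⟩, ha.symm.trans h⟩
    · rintro ⟨⟨a, ha⟩, h⟩
      exact ⟨a, ha, ha.trans h⟩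

@[fun_prop]
theorem Dfn.eq {f g : α → β} (hf : Dfn M f) (hg : Dfn M g) : Dfn M fun a => f a = g a := by
  have : Dfn M fun p : M × M => ∀ z, z ∈ₘ p.1 ↔ z ∈ₘ p.2 := by fun_prop
  refine (this.comp ((Dfn.code_fun.comp hf).mk (Dfn.code_fun.comp hg))).pred_congr fun a => ?_
  exact ⟨fun h z => by rw [h], fun h => Coded.code_injective (ext h)⟩

theorem dfn_iff_graph {f : α → β} : Dfn M f ↔ Dfn M fun p : α × β => p.2 = f p.1 := by
  refine ⟨fun h => by fun_prop, fun h => ?_⟩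
  rw [dfn_pred_iff] at h
  have hP' := fun i : Option Bool => h.reindex fun _ => i
  refine (DefPred.ex (P := fun v y => IsOPair y (v false) (v true) ∧
    ∃ p : α × β, ZFModel.code p = y ∧ p.2 = f p.1) ((DefPred.isOPair _ _ _).and (hP' _))).congr
      fun v => ?_
  simp only [isOPair_iff, Prod.exists, code_mk]
  constructor
  · rintro ⟨a, h, h'⟩
    exact ⟨_, rfl, a, _, by rw [h, h'], rfl⟩
  · rintro ⟨_, rfl, a, b, h, rfl⟩
    exact ⟨a, opair_inj.1 h⟩

/-- A function is definable if its graph is the graph of a definable relation. -/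
theorem Dfn.of_graph {f : α → β} {R : α → β → Prop} (h : Dfn M fun p : α × β => R p.1 p.2)
    (e : ∀ a b, R a b ↔ b = f a) : Dfn M f :=
  dfn_iff_graph.2 (h.pred_congr fun p => (e p.1 p.2).symm)

end Dfn
/-! ### Separation, replacement and power sets for coded types -/

section Sets

variable {M : Type u} [setLang.Structure M] [IsZFModel M]

theorem Dfn.defPred {P : M → Prop} (h : Dfn M P) {ι : Type} (i : ι) :
    DefPred fun v : ι → M => P (v i) :=
  ((dfn_pred_iff.1 h).reindex fun _ => i).congr fun v =>
    ⟨fun h => ⟨_, rfl, h⟩, fun ⟨_, h, h'⟩ => (show _ = v i from h) ▸ h'⟩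

theorem exists_sep {P : M → Prop} (h : Dfn M P) (a : M) : ∃ b : M, ∀ z, z ∈ₘ b ↔ z ∈ₘ a ∧ P z :=
  IsZFModel.separation {z | P z} (h.defPred (0 : Fin 1)) a

theorem exists_replace {F : M → M} (h : Dfn M F) (a : M) :
    ∃ b : M, ∀ y, y ∈ₘ b ↔ ∃ x, x ∈ₘ a ∧ F x = y := by
  have := h.at (0 : Fin 2) 1
  refine IsZFModel.replacement {p : M × M | F p.1 = p.2} (this.congr fun v => ?_) a
    fun x _ => ⟨F x, rfl, fun y hy => hy.symm⟩
  simp [code]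

/-- The elements of `α` are represented by the members of a set of the model. -/
class Small (M : Type u) [setLang.Structure M] (α : Type v) [Coded M α] : Prop where
  exists_range : ∃ A : M, ∀ m, m ∈ₘ A ↔ ∃ a : α, code a = m

variable {α : Type v} {β : Type w} {γ : Type x} [Coded M α] [Coded M β] [Coded M γ]

theorem exists_comprehension [Small M α] {P : α → Prop} (h : Dfn M P) :
    ∃ s : M, ∀ m, m ∈ₘ s ↔ ∃ a, code a = m ∧ P a := by
  obtain ⟨A, hA⟩ := Small.exists_range (M := M) (α := α)
  obtain ⟨s, hs⟩ := exists_sep (P := fun m => ∃ a, code a = m ∧ P a) (by fun_prop) A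
  refine ⟨s, fun m => (hs m).trans ⟨fun h => h.2, fun h => ⟨(hA m).2 ?_, h⟩⟩⟩
  exact h.imp fun a ha => ha.1

/-- Replacement gives the slice over each `x`, a second replacement collects the slices, and their
union is the product. The second one requires the map from `x` to its slice to be definable. -/
instance [Small M α] [Small M β] : Small M (α × β) where
  exists_range := by
    obtain ⟨A, hA⟩ := Small.exists_range (M := M) (α := α)
    obtain ⟨B, hB⟩ := Small.exists_range (M := M) (α := β)
    choose G hG using fun x : M => exists_replace (F := fun y => code (x, y)) (by fun_prop) B
    have hGd : Dfn M G := Dfn.of_graph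
      (R := fun x z => ∀ p, p ∈ₘ z ↔ ∃ y, y ∈ₘ B ∧ code (x, y) = p) (by fun_prop) fun x z =>
      ⟨fun h => ext fun p => (h p).trans (hG x p).symm, fun h => h ▸ hG x⟩
    obtain ⟨C, hC⟩ := exists_replace hGd A
    obtain ⟨U, hU⟩ := IsZFModel.union C
    refine ⟨U, fun m => (hU m).trans ⟨?_, ?_⟩⟩
    · rintro ⟨z, hz, hm⟩
      obtain ⟨x, hx, rfl⟩ := (hC z).1 hz
      obtain ⟨y, hy, rfl⟩ := (hG x m).1 hm
      obtain ⟨a, rfl⟩ := (hA x).1 hx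
      obtain ⟨b, rfl⟩ := (hB y).1 hy
      exact ⟨(a, b), rfl⟩
    · rintro ⟨p, rfl⟩
      exact ⟨G (code p.1), (hC _).2 ⟨_, (hA _).2 ⟨_, rfl⟩, rfl⟩,
        (hG _ _).2 ⟨_, (hB _).2 ⟨_, rfl⟩, rfl⟩⟩

/-! ### Types embedded into coded types -/

variable (M) in
/-- A type that is embedded onto a definable part of a coded type is coded. -/
abbrev Coded.ofInjective (f : γ → β) (hf : Function.Injective f)
    (hr : Dfn M fun b => ∃ c, f c = b) : Coded M γ where
  code c := code (f c)
  code_injective := Coded.code_injective.comp hf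
  defPred_range := (dfn_pred_iff.1 hr).congr fun v => by grind

/-- A map that preserves codes is an inclusion of classes of the model. -/
theorem Dfn.of_code_eq {f : γ → β} (h : ∀ c, (code (f c) : M) = code c) : Dfn M f :=
  Dfn.of_graph (R := fun c b => (code b : M) = code c) (by fun_prop) fun c b => by
    rw [← h]; exact Coded.code_injective.eq_iff

theorem dfn_comp_iff_of_code_eq {f : γ → β} (h : ∀ c, (code (f c) : M) = code c) {g : α → γ} :
    Dfn M (fun a => f (g a)) ↔ Dfn M g := by
  refine ⟨fun hg => ?_, fun hg => (Dfn.of_code_eq h).comp hg⟩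
  obtain ⟨k, hk⟩ : ∃ k, k = fun a => f (g a) := ⟨_, rfl⟩
  rw [← hk] at hg
  refine Dfn.of_graph (R := fun a c => (code c : M) = code (k a)) (by fun_prop) fun a c => ?_
  rw [hk, h]; exact Coded.code_injective.eq_iff

theorem Small.of_code_eq [Small M β] {f : γ → β} (h : ∀ c, (code (f c) : M) = code c) :
    Small M γ where
  exists_range := by
    have h' := Dfn.of_code_eq h
    obtain ⟨s, hs⟩ := exists_comprehension (M := M) (P := fun b => ∃ c, f c = b) (by fun_prop)
    refine ⟨s, fun m => (hs m).trans ⟨?_, ?_⟩⟩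
    · rintro ⟨_, rfl, c, rfl⟩
      exact ⟨c, (h c).symm⟩
    · rintro ⟨c, rfl⟩
      exact ⟨_, h c, c, rfl⟩

theorem Dfn.of_surjective {π : α → γ} (hπ : Dfn M π) (hs : Function.Surjective π) {f : γ → β}
    (hf : Dfn M fun a => f (π a)) : Dfn M f := by
  obtain ⟨g, hg⟩ : ∃ g, g = fun a => f (π a) := ⟨_, rfl⟩
  rw [← hg] at hf
  refine Dfn.of_graph (R := fun c b => ∃ a, π a = c ∧ b = g a) (by fun_prop) fun c b => ?_
  obtain ⟨a, rfl⟩ := hs c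
  grind

theorem Dfn.of_surjective₂ {δ : Type*} [Coded M δ] {π : α → γ} (hπ : Dfn M π)
    (hs : Function.Surjective π) {f : γ → γ → δ}
    (hf : Dfn M fun p : α × α => f (π p.1) (π p.2)) : Dfn M fun p : γ × γ => f p.1 p.2 :=
  Dfn.of_surjective (π := fun p : α × α => (π p.1, π p.2)) (by fun_prop)
    (fun p => by obtain ⟨⟨a, ha⟩, b, hb⟩ := And.intro (hs p.1) (hs p.2)
                 exact ⟨(a, b), by simp [*]⟩)
    hf

/-! ### Members of a set -/

instance (a : M) : Coded M (Elt a) :=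
  Coded.ofInjective M (Subtype.val : Elt a → M) Subtype.val_injective <|
    (show Dfn M fun b : M => b ∈ₘ a by fun_prop).pred_congr fun b =>
      ⟨fun ⟨c, h⟩ => h ▸ c.2, fun h => ⟨⟨b, h⟩, rfl⟩⟩

theorem code_elt {a : M} (c : Elt a) : (code c : M) = c.1 := rfl

instance (a : M) : Small M (Elt a) where
  exists_range := ⟨a, fun m => ⟨fun h => ⟨⟨m, h⟩, rfl⟩, fun ⟨c, h⟩ => h ▸ c.2⟩⟩

@[fun_prop]
theorem Dfn.val {a : M} {f : α → Elt a} (hf : Dfn M f) : Dfn M fun x => (f x).1 :=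
  Dfn.code_fun.comp hf

theorem Dfn.to_elt {a : M} {f : α → Elt a} (hf : Dfn M fun x => (f x).1) : Dfn M f :=
  (dfn_comp_iff_of_code_eq (f := fun c : Elt a => c.1) fun _ => rfl).1 hf

/-! ### Subsets -/

variable (M α) in
/-- A subset of `α` that is definable with parameters. -/
structure ISet where
  carrier : Set α
  dfn : Dfn M fun a => a ∈ carrier

instance : SetLike (ISet M α) α where
  coe := ISet.carrier
  coe_injective := fun ⟨_, _⟩ ⟨_, _⟩ h => by cases h; rfl

theorem ISet.dfn_mem (S : ISet M α) : Dfn M fun a => a ∈ S := S.dfn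

/-- Comprehension makes each definable subset a set of the model, and each set of codes defines a
subset with itself as parameter. Quantifying over definable subsets thus becomes first-order. -/
noncomputable instance [Small M α] : Coded M (ISet M α) where
  code S := (exists_comprehension S.dfn).choose
  code_injective S T h := SetLike.ext fun a => by
    have hS := (exists_comprehension S.dfn).choose_spec (code a)
    have hT := (exists_comprehension T.dfn).choose_spec (code a)
    beta_reduce at h
    rw [← h, hS] at hT
    simp only [Coded.code_injective.eq_iff, exists_eq_left] at hT
    exact hT
  defPred_range := by
    have : Dfn M fun m : M => ∀ z, z ∈ₘ m → ∃ a : α, code a = z := by fun_prop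
    refine (this.defPred ()).congr fun v => ⟨?_, fun h => ?_⟩
    · rintro ⟨S, hS⟩ z hz
      rw [← hS] at hz
      exact (((exists_comprehension S.dfn).choose_spec z).1 hz).imp fun _ h => h.1
    · have hd : Dfn M fun a : α => code a ∈ₘ v () := by fun_prop
      refine ⟨⟨{a | code a ∈ₘ v ()}, hd⟩, ext fun z => ?_⟩
      rw [(exists_comprehension hd).choose_spec z]
      constructor
      · rintro ⟨a, rfl, h⟩; exact h
      · intro hz
        obtain ⟨a, rfl⟩ := h z hz
        exact ⟨a, rfl, hz⟩

theorem mem_code_iSet [Small M α] {S : ISet M α} {m : M} :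
    m ∈ₘ code S ↔ ∃ a, code a = m ∧ a ∈ S :=
  (exists_comprehension S.dfn).choose_spec m

theorem code_mem_code [Small M α] {S : ISet M α} {a : α} :
    (code a : M) ∈ₘ code S ↔ a ∈ S := by
  simp [mem_code_iSet, Coded.code_injective.eq_iff]

@[fun_prop]
theorem Dfn.mem_iSet [Small M β] {f : α → β} {S : α → ISet M β} (hf : Dfn M f) (hS : Dfn M S) :
    Dfn M fun a => f a ∈ S a :=
  (show Dfn M fun a => (ZFModel.code (f a) : M) ∈ₘ ZFModel.code (S a) by fun_prop).pred_congr
    fun _ => code_mem_code.symm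

theorem Dfn.to_iSet [Small M β] {S : α → ISet M β} (hS : Dfn M fun p : α × β => p.2 ∈ S p.1) :
    Dfn M S :=
  Dfn.of_graph (R := fun a T => ∀ b, b ∈ T ↔ b ∈ S a)
    (.all (.iff (by fun_prop) (hS.comp (f := fun p : (α × ISet M β) × β => (p.1.1, p.2))
      (by fun_prop)))) fun _ _ => SetLike.ext_iff.symm

instance [Small M α] : Small M (ISet M α) where
  exists_range := by
    obtain ⟨A, hA⟩ := Small.exists_range (M := M) (α := α)
    obtain ⟨p, hp⟩ := IsZFModel.power A
    obtain ⟨s, hs⟩ := exists_sep (P := fun m => ∃ S : ISet M α, code S = m) (by fun_prop) p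
    refine ⟨s, fun m => (hs m).trans ⟨fun h => h.2, fun h => ⟨(hp m).2 ?_, h⟩⟩⟩
    rintro t ht
    obtain ⟨S, rfl⟩ := h
    exact (hA t).2 ((mem_code_iSet.1 ht).imp fun _ h => h.1)

/-! ### Functions -/

variable (M α β) in
/-- A function that is definable with parameters. -/
structure IFun where
  toFun : α → β
  dfn : Dfn M toFun

instance : FunLike (IFun M α β) α β where
  coe := IFun.toFun
  coe_injective := fun ⟨_, _⟩ ⟨_, _⟩ h => by cases h; rfl

/-- The graph of a function. -/
def IFun.graph (f : IFun M α β) : ISet M (α × β) := ⟨{p | p.2 = f p.1}, dfn_iff_graph.1 f.dfn⟩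

/-- Functions are coded by their graphs, and being total and single-valued is a first-order
condition on a graph. -/
noncomputable instance [Small M α] [Small M β] : Coded M (IFun M α β) := by
  refine Coded.ofInjective M IFun.graph (fun f g h => DFunLike.ext _ _ fun a => ?_)
    (Dfn.pred_congr (P := fun S => ∀ a, ∃ b, (a, b) ∈ S ∧ ∀ c, (a, c) ∈ S → c = b)
    (by fun_prop) fun S => ⟨?_, fun h => ?_⟩)
  · have : (a, f a) ∈ g.graph := h ▸ (rfl : f a = f a)
    exact this
  · rintro ⟨f, rfl⟩ a
    exact ⟨f a, rfl, fun c h => h⟩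
  · choose f hf hf' using h
    have e : ∀ a b, (a, b) ∈ S ↔ b = f a := fun a b => ⟨hf' a b, fun h => h ▸ hf a⟩
    exact ⟨⟨f, Dfn.of_graph S.dfn_mem e⟩, SetLike.ext fun p => (e p.1 p.2).symm⟩

theorem code_graph [Small M α] [Small M β] (f : IFun M α β) : (code f.graph : M) = code f := rfl

instance [Small M α] [Small M β] : Small M (IFun M α β) := Small.of_code_eq code_graph

@[fun_prop]
theorem Dfn.app [Small M β] [Small M γ] {f : α → IFun M β γ} {g : α → β} (hf : Dfn M f)
    (hg : Dfn M g) : Dfn M fun a => f a (g a) := by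
  have : Dfn M (IFun.graph : IFun M β γ → _) := Dfn.of_code_eq code_graph
  exact Dfn.of_graph (R := fun a c => (g a, c) ∈ (f a).graph) (by fun_prop) fun _ _ => Iff.rfl

theorem Dfn.to_iFun [Small M β] [Small M γ] {f : α → IFun M β γ}
    (hf : Dfn M fun p : α × β => f p.1 p.2) : Dfn M f := by
  refine Dfn.of_graph (R := fun a g => ∀ b, g b = f a b) (.all (.eq (by fun_prop)
    (hf.comp (f := fun p : (α × IFun M β γ) × β => (p.1.1, p.2)) (by fun_prop)))) fun a g => ?_
  exact DFunLike.ext_iff.symm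

/-! ### Quotients -/

/-- The fibre of a map with definable kernel. -/
def fibre {π : α → γ} (hs : Function.Surjective π)
    (hk : Dfn M fun p : α × α => π p.1 = π p.2) (c : γ) : ISet M α :=
  ⟨{a | π a = c}, by
    obtain ⟨b, rfl⟩ := hs c
    exact hk.comp (f := fun a => (a, b)) (by fun_prop)⟩

end Sets
section Quotient

variable {M : Type u} [setLang.Structure M] [IsZFModel M]
  {α : Type v} {γ : Type x} [Coded M α] [Small M α]

/-- A quotient of a coded type by a definable relation is coded, by the classes. -/
noncomputable abbrev Coded.ofSurjective {π : α → γ} (hs : Function.Surjective π)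
    (hk : Dfn M fun p : α × α => π p.1 = π p.2) : Coded M γ :=
  Coded.ofInjective M (fibre hs hk)
    (fun c d h => by
      obtain ⟨a, rfl⟩ := hs c
      exact (h ▸ (rfl : π a = π a) : a ∈ fibre hs hk d))
    (Dfn.pred_congr (P := fun S => ∃ a, ∀ b, b ∈ S ↔ π b = π a)
      (.ex (.all (.iff (by fun_prop) (hk.comp (f := fun p : (ISet M α × α) × α => (p.2, p.1.2))
        (by fun_prop))))) fun S => by
      constructor
      · rintro ⟨c, rfl⟩
        obtain ⟨a, rfl⟩ := hs c
        exact ⟨a, fun _ => Iff.rfl⟩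
      · rintro ⟨a, ha⟩
        exact ⟨π a, SetLike.ext fun b => (ha b).symm⟩)

theorem dfn_of_code_fibre [Coded M γ] {π : α → γ} (hs : Function.Surjective π)
    (hk : Dfn M fun p : α × α => π p.1 = π p.2)
    (h : ∀ c, (code (fibre hs hk c) : M) = code c) : Dfn M π := by
  have := Dfn.of_code_eq h
  exact Dfn.of_graph (R := fun a c => a ∈ fibre hs hk c) (by fun_prop) fun a c => eq_comm

end Quotient

/-! ### Functions, relations and subsets of the model are the definable ones -/

section Bridge

variable {M : Type u} [setLang.Structure M] [IsZFModel M] {a b c : M}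

theorem isGraph_iff {g : M} {f : Elt a → Elt b} :
    IsGraph g f ↔ ∀ p, p ∈ₘ g ↔ ∃ x, code (x, f x) = p := by
  simp only [IsGraph, isOPair_iff, code_mk, code_elt, eq_comm]

/-- A graph in the model serves as a parameter defining the function; conversely separation cuts a
definable graph out of the product. -/
theorem internal_iff {f : Elt a → Elt b} : Internal f ↔ Dfn M f := by
  simp only [Internal, isGraph_iff]
  constructor
  · rintro ⟨g, hg⟩
    refine Dfn.of_graph (R := fun x y => code (x, y) ∈ₘ g) (by fun_prop) fun x y => ?_
    rw [hg]
    refine ⟨?_, fun h => ⟨x, h ▸ rfl⟩⟩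
    rintro ⟨z, hz⟩
    cases Coded.code_injective hz
    rfl
  · intro h
    obtain ⟨s, hs⟩ := exists_comprehension (M := M) (P := fun p : Elt a × Elt b => p.2 = f p.1)
      (by fun_prop)
    refine ⟨s, fun p => (hs p).trans ⟨?_, ?_⟩⟩
    · rintro ⟨⟨x, y⟩, rfl, h'⟩
      exact ⟨x, by rw [← h']⟩
    · rintro ⟨x, hp⟩
      exact ⟨_, hp, rfl⟩

theorem internal₂_iff {f : Elt a → Elt b → Elt c} :
    Internal₂ f ↔ Dfn M fun p : Elt a × Elt b => f p.1 p.2 := by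
  have e : ∀ p, (∃ (x : Elt a) (y : Elt b) (q : M), IsOPair q x.1 y.1 ∧ IsOPair p q (f x y).1) ↔
      ∃ z : Elt a × Elt b, code (z, f z.1 z.2) = p := by
    simp only [isOPair_iff, code_mk, code_elt, Prod.exists, exists_eq_left, eq_comm, implies_true]
  simp only [Internal₂, e]
  constructor
  · rintro ⟨g, hg⟩
    refine Dfn.of_graph (R := fun x y => code (x, y) ∈ₘ g) (by fun_prop) fun x y => ?_
    rw [hg]
    refine ⟨?_, fun h => ⟨x, h ▸ rfl⟩⟩
    rintro ⟨z, hz⟩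
    cases Coded.code_injective hz
    rfl
  · intro h
    obtain ⟨s, hs⟩ := exists_comprehension (M := M)
      (P := fun p : (Elt a × Elt b) × Elt c => p.2 = f p.1.1 p.1.2) (.eq (by fun_prop)
        (h.comp Dfn.fst))
    refine ⟨s, fun p => (hs p).trans ⟨?_, ?_⟩⟩
    · rintro ⟨⟨x, y⟩, rfl, h'⟩
      exact ⟨x, by rw [← h']⟩
    · rintro ⟨x, hp⟩
      exact ⟨_, hp, rfl⟩

theorem internalRel_iff {r : Elt a → Elt a → Prop} :
    InternalRel r ↔ Dfn M fun p : Elt a × Elt a => r p.1 p.2 := by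
  have e : ∀ p, (∃ x y : Elt a, IsOPair p x.1 y.1 ∧ r x y) ↔
      ∃ z : Elt a × Elt a, code z = p ∧ r z.1 z.2 := by
    simp only [isOPair_iff, code_mk, code_elt, Prod.exists, eq_comm, implies_true]
  simp only [InternalRel, e]
  constructor
  · rintro ⟨g, hg⟩
    refine Dfn.pred_congr (P := fun x => code x ∈ₘ g) (by fun_prop) fun x => ?_
    simp [hg, Coded.code_injective.eq_iff]
  · exact exists_comprehension

theorem internalSet_iff {S : Set (Elt a)} : InternalSet S ↔ Dfn M fun x => x ∈ S := by
  constructor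
  · rintro ⟨g, hg⟩
    exact Dfn.pred_congr (P := fun x : Elt a => code x ∈ₘ g) (by fun_prop) fun x =>
      ⟨fun h => (hg x.1).2 ⟨x.2, h⟩, fun h => ((hg x.1).1 h).2⟩
  · intro h
    obtain ⟨s, hs⟩ := exists_comprehension h
    refine ⟨s, fun m => (hs m).trans ⟨?_, fun ⟨h, h'⟩ => ⟨_, rfl, h'⟩⟩⟩
    rintro ⟨x, rfl, hx⟩
    exact ⟨x.2, hx⟩

end Bridge

/-! ### Finite sets -/

section Finite

variable {M : Type u} [setLang.Structure M] [IsZFModel M]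

theorem exists_insert (y z : M) : ∃ w : M, ∀ t, t ∈ₘ w ↔ t ∈ₘ y ∨ t = z := by
  obtain ⟨s, hs⟩ := IsZFModel.pairing z z
  obtain ⟨p, hp⟩ := IsZFModel.pairing y s
  obtain ⟨w, hw⟩ := IsZFModel.union p
  refine ⟨w, fun t => (hw t).trans ?_⟩
  simp [hp, or_and_right, exists_or, hs]

theorem isFin_empty {e : M} (he : ∀ t, ¬ t ∈ₘ e) : IsFin e := fun _ h _ => h e he

theorem IsFin.insert {y z w : M} (hy : IsFin y) (hw : ∀ t, t ∈ₘ w ↔ t ∈ₘ y ∨ t = z) :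
    IsFin w := fun F h0 h1 =>
  h1 y z w (hy F h0 fun y' z' w' hy' hz' hw' => h1 y' z' w' hy' ((hw _).2 (Or.inl hz')) hw')
    ((hw _).2 (Or.inr rfl)) hw

/-- The definition of finiteness is applied to the family of those subsets of `x` that satisfy `P`,
a set by the power set axiom and separation. -/
theorem IsFin.induction {x : M} (hx : IsFin x) {P : M → Prop} (hP : Dfn M P)
    (empty : ∀ e, (∀ t, ¬ t ∈ₘ e) → P e)
    (insert : ∀ y z w, P y → z ∈ₘ x → Sub y x → (∀ t, t ∈ₘ w ↔ t ∈ₘ y ∨ t = z) → P w) : P x := by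
  obtain ⟨p, hp⟩ := IsZFModel.power x
  obtain ⟨F, hF⟩ := exists_sep hP p
  refine ((hF x).1 (hx F (fun e he => (hF e).2 ⟨(hp e).2 fun t ht => (he t ht).elim, empty e he⟩)
    fun y z w hy hz hw => ?_)).2
  have hy' := (hF y).1 hy
  have hs := (hp y).1 hy'.1
  refine (hF w).2 ⟨(hp w).2 fun t ht => ?_, insert y z w hy'.2 hz hs hw⟩
  rcases (hw t).1 ht with h | rfl
  exacts [hs t h, hz]

@[fun_prop]
theorem Dfn.sub {α : Type v} [Coded M α] {f g : α → M} (hf : Dfn M f) (hg : Dfn M g) :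
    Dfn M fun a => Sub (f a) (g a) := by
  unfold Sub
  fun_prop

@[fun_prop]
theorem Dfn.isFin {α : Type v} [Coded M α] {f : α → M} (hf : Dfn M f) :
    Dfn M fun a => IsFin (f a) := by
  unfold IsFin
  fun_prop

end Finite
/-! ### The natural numbers of the model -/

section Omega

variable {M : Type u} [setLang.Structure M] [IsZFModel M]

/-- `w` is a set of natural numbers, with zero and the successor function. -/
structure IsOmega (w : M) (zero : Elt w) (succ : Elt w → Elt w) : Prop where
  dfn_succ : Dfn M succ
  succ_injective : Function.Injective succ
  succ_ne_zero : ∀ n, succ n ≠ zero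
  induction : ∀ P : Elt w → Prop, Dfn M P → P zero → (∀ n, P n → P (succ n)) → ∀ n, P n

theorem exists_isOmega : ∃ (w : M) (zero : Elt w) (succ : Elt w → Elt w), IsOmega w zero succ := by
  obtain ⟨i, ⟨e, hei, he⟩, hi⟩ := IsZFModel.infinity (M := M)
  choose s hs using fun x : M => exists_insert x x
  have hsd : Dfn M s := Dfn.of_graph (R := fun x y => ∀ t, t ∈ₘ y ↔ t ∈ₘ x ∨ t = x) (by fun_prop)
    fun x y => ⟨fun h => ext fun t => (h t).trans (hs x t).symm, fun h => h ▸ hs x⟩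
  -- If `x ≠ y` had the same successor, each would be a member of the other, against foundation for
  -- the pair.
  have hsi : Function.Injective s := by
    intro x y h
    by_contra hne
    have hx : x ∈ₘ y := ((hs y x).1 (h ▸ (hs x x).2 (Or.inr rfl))).resolve_right hne
    have hy : y ∈ₘ x := ((hs x y).1 (h ▸ (hs y y).2 (Or.inr rfl))).resolve_right (Ne.symm hne)
    obtain ⟨p, hp⟩ := IsZFModel.pairing x y
    obtain ⟨z, hz, hz'⟩ := IsZFModel.foundation p ⟨x, (hp x).2 (Or.inl rfl)⟩
    rcases (hp z).1 hz with rfl | rfl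
    · exact hz' y ((hp y).2 (Or.inr rfl)) hy
    · exact hz' x ((hp x).2 (Or.inl rfl)) hx
  have hsI : ∀ x, x ∈ₘ i → s x ∈ₘ i := fun x hx => by
    obtain ⟨t, ht, h⟩ := hi x hx
    rwa [ext fun z => (hs x z).trans (h z).symm]
  -- The intersection of all inductive sets, so that induction holds for every definable predicate.
  obtain ⟨w, hw⟩ := exists_sep
    (P := fun x => ∀ j, e ∈ₘ j → (∀ y, y ∈ₘ j → s y ∈ₘ j) → x ∈ₘ j) (by fun_prop) i
  refine ⟨w, ⟨e, (hw e).2 ⟨hei, fun j h _ => h⟩⟩, fun n => ⟨s n.1, (hw _).2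
    ⟨hsI _ ((hw _).1 n.2).1, fun j h h' => h' _ (((hw _).1 n.2).2 j h h')⟩⟩, ?_, ?_, ?_, ?_⟩
  · exact Dfn.to_elt (by fun_prop)
  · intro m n h
    exact Subtype.ext (hsi (congrArg Subtype.val h))
  · intro n h
    have : s n.1 = e := congrArg Subtype.val h
    exact he n.1 (this ▸ (hs _ _).2 (Or.inr rfl))
  · intro P hP h0 h1 n
    obtain ⟨j, hj⟩ := exists_comprehension hP
    obtain ⟨m, hm, h⟩ := (hj _).1 (((hw _).1 n.2).2 j ((hj _).2 ⟨_, rfl, h0⟩) fun y hy => by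
      obtain ⟨m, rfl, h⟩ := (hj _).1 hy
      exact (hj _).2 ⟨_, rfl, h1 m h⟩)
    cases Subtype.ext hm
    exact h

variable (M) in
/-- The natural numbers of the model. -/
def Omega : Type u := Elt (exists_isOmega (M := M)).choose

namespace Omega

noncomputable instance : Coded M (Omega M) :=
  inferInstanceAs (Coded M (Elt (exists_isOmega (M := M)).choose))

instance : Small M (Omega M) := inferInstanceAs (Small M (Elt (exists_isOmega (M := M)).choose))

noncomputable instance : Zero (Omega M) := ⟨(exists_isOmega (M := M)).choose_spec.choose⟩

/-- The successor function. -/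
noncomputable def succ : Omega M → Omega M :=
  (exists_isOmega (M := M)).choose_spec.choose_spec.choose

theorem isOmega : IsOmega (exists_isOmega (M := M)).choose (0 : Omega M) succ :=
  (exists_isOmega (M := M)).choose_spec.choose_spec.choose_spec

@[fun_prop]
theorem dfn_succ : Dfn M (succ : Omega M → Omega M) := isOmega.dfn_succ

theorem succ_inj {m n : Omega M} : succ m = succ n ↔ m = n := isOmega.succ_injective.eq_iff

theorem succ_ne_zero (n : Omega M) : succ n ≠ 0 := isOmega.succ_ne_zero n

theorem ind {P : Omega M → Prop} (hP : Dfn M P) (h0 : P 0) (h1 : ∀ n, P n → P (succ n)) :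
    ∀ n, P n := isOmega.induction P hP h0 h1

/-- Recursion with a parameter. -/
theorem exists_rec {α : Type v} {β : Type w} [Coded M α] [Coded M β] [Small M α]
    {f : β → α} {g : β → α → α} (hf : Dfn M f) (hg : Dfn M fun p : β × α => g p.1 p.2) :
    ∃ h : β → Omega M → α, (Dfn M fun p : β × Omega M => h p.1 p.2) ∧ (∀ b, h b 0 = f b) ∧
      ∀ b n, h b (succ n) = g b (h b n) := by
  -- An opaque uncurried copy of `g`, so that `fun_prop` can use its definability as a hypothesis.
  -- The same device recurs below.
  obtain ⟨G, hG, hGd⟩ : ∃ G : β × α → α, (∀ b a, G (b, a) = g b a) ∧ Dfn M G :=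
    ⟨_, fun _ _ => rfl, hg⟩
  let Cl (b : β) (S : ISet M (Omega M × α)) : Prop :=
    (0, f b) ∈ S ∧ ∀ n a, (n, a) ∈ S → (succ n, G (b, a)) ∈ S
  -- The least relation containing the initial value and closed under the recursion step.
  let R (b : β) (n : Omega M) (a : α) : Prop := ∀ S, Cl b S → (n, a) ∈ S
  have hRd : Dfn M fun p : (β × Omega M) × α => R p.1.1 p.1.2 p.2 := by
    unfold R Cl
    fun_prop
  have hR (b : β) : Dfn M fun p : Omega M × α => R b p.1 p.2 :=
    hRd.comp (f := fun p : Omega M × α => ((b, p.1), p.2)) (by fun_prop)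
  have h0 (b : β) : R b 0 (f b) := fun S hS => hS.1
  have h1 (b : β) (n : Omega M) (a : α) (h : R b n a) : R b (succ n) (G (b, a)) :=
    fun S hS => hS.2 _ _ (h S hS)
  -- By minimality: the pairs that are initial or arise from a pair in `R` by one step already form
  -- a closed set.
  have hinv (b : β) (n : Omega M) (a : α) (h : R b n a) :
      n = 0 ∧ a = f b ∨ ∃ n' a', R b n' a' ∧ n = succ n' ∧ a = G (b, a') := by
    have hd : Dfn M fun p : Omega M × α => p.1 = 0 ∧ p.2 = f b ∨ ∃ q : Omega M × α,
        R b q.1 q.2 ∧ p.1 = succ q.1 ∧ p.2 = G (b, q.2) :=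
      .or (by fun_prop) (.ex (.and ((hR b).comp Dfn.snd) (by fun_prop)))
    have hc : Cl b ⟨{p | _}, hd⟩ := by
      refine ⟨Or.inl ⟨rfl, rfl⟩, ?_⟩
      rintro n a (⟨rfl, rfl⟩ | ⟨q, hq, h, h'⟩)
      · exact Or.inr ⟨(0, f b), h0 b, rfl, rfl⟩
      · exact Or.inr ⟨(n, a), by rw [show n = _ from h, show a = _ from h']; exact h1 _ _ _ hq,
          rfl, rfl⟩
    rcases h _ hc with h | ⟨q, h⟩
    · exact Or.inl h
    · exact Or.inr ⟨_, _, h⟩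
  have hu (b : β) : ∀ n, ∃ a, R b n a ∧ ∀ a', R b n a' → a' = a := by
    refine ind (.ex (.and (hR b) (.all (.imp ((hR b).comp (f := fun p : (Omega M × α) × α =>
      (p.1.1, p.2)) (by fun_prop)) (by fun_prop))))) ⟨f b, h0 b, fun a' h => ?_⟩ ?_
    · rcases hinv _ _ _ h with h | ⟨_, _, _, h, _⟩
      · exact h.2
      · exact (succ_ne_zero _ h.symm).elim
    · rintro n ⟨a, ha, hu⟩
      refine ⟨_, h1 _ _ _ ha, fun a' h => ?_⟩
      rcases hinv _ _ _ h with h | ⟨m, c, hc, e, rfl⟩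
      · exact (succ_ne_zero _ h.1).elim
      · cases succ_inj.1 e
        rw [hu c hc]
  choose h hh hh' using hu
  refine ⟨h, ?_, fun b => (hh' _ _ _ (h0 b)).symm, fun b n => ?_⟩
  · exact Dfn.of_graph (R := fun p a => R p.1 p.2 a) hRd
      fun p a => ⟨hh' _ _ _, fun e => e ▸ hh _ _⟩
  · rw [← hG]
    exact (hh' _ _ _ (h1 _ _ _ (hh b n))).symm

theorem exists_add : ∃ h : Omega M → Omega M → Omega M,
    (Dfn M fun p : Omega M × Omega M => h p.1 p.2) ∧ (∀ b, h b 0 = b) ∧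
      ∀ b n, h b (succ n) = succ (h b n) :=
  exists_rec (f := fun b => b) (g := fun _ a => succ a) (by fun_prop) (by fun_prop)

noncomputable instance : Add (Omega M) := ⟨exists_add.choose⟩

theorem add_zero' (b : Omega M) : b + 0 = b := exists_add.choose_spec.2.1 b

theorem add_succ (b n : Omega M) : b + succ n = succ (b + n) := exists_add.choose_spec.2.2 b n

@[fun_prop]
theorem dfn_add {α : Type v} [Coded M α] {f g : α → Omega M} (hf : Dfn M f) (hg : Dfn M g) :
    Dfn M fun a => f a + g a :=
  exists_add.choose_spec.1.comp (hf.mk hg)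

theorem exists_mul : ∃ h : Omega M → Omega M → Omega M,
    (Dfn M fun p : Omega M × Omega M => h p.1 p.2) ∧ (∀ b, h b 0 = 0) ∧
      ∀ b n, h b (succ n) = h b n + b :=
  exists_rec (f := fun _ => 0) (g := fun b a => a + b) (by fun_prop) (by fun_prop)

noncomputable instance : Mul (Omega M) := ⟨exists_mul.choose⟩

theorem mul_zero' (b : Omega M) : b * 0 = 0 := exists_mul.choose_spec.2.1 b

theorem mul_succ (b n : Omega M) : b * succ n = b * n + b := exists_mul.choose_spec.2.2 b n

@[fun_prop]
theorem dfn_mul {α : Type v} [Coded M α] {f g : α → Omega M} (hf : Dfn M f) (hg : Dfn M g) :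
    Dfn M fun a => f a * g a :=
  exists_mul.choose_spec.1.comp (hf.mk hg)

noncomputable instance : One (Omega M) := ⟨succ 0⟩

theorem one_def : (1 : Omega M) = succ 0 := rfl

theorem zero_add' (n : Omega M) : 0 + n = n :=
  ind (P := fun n => 0 + n = n) (by fun_prop) (add_zero' 0)
    (fun n h => by rw [add_succ, h]) n

theorem succ_add (m n : Omega M) : succ m + n = succ (m + n) :=
  ind (P := fun n => succ m + n = succ (m + n)) (by fun_prop) (by simp only [add_zero'])
    (fun n h => by simp only [add_succ, h]) n

theorem add_comm' (m n : Omega M) : m + n = n + m :=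
  ind (P := fun n => m + n = n + m) (by fun_prop) (by rw [add_zero', zero_add'])
    (fun n h => by rw [add_succ, succ_add, h]) n

theorem add_assoc' (k m n : Omega M) : k + m + n = k + (m + n) :=
  ind (P := fun n => k + m + n = k + (m + n)) (by fun_prop) (by simp only [add_zero'])
    (fun n h => by simp only [add_succ, h]) n

noncomputable instance : AddCommMonoid (Omega M) where
  add_assoc := add_assoc'
  zero_add := zero_add'
  add_zero := add_zero'
  add_comm := add_comm'
  nsmul := nsmulRec

theorem succ_eq (n : Omega M) : succ n = n + 1 := by rw [one_def, add_succ, add_zero]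

theorem zero_mul' (n : Omega M) : 0 * n = 0 :=
  ind (P := fun n => 0 * n = 0) (by fun_prop) (mul_zero' 0)
    (fun n h => by rw [mul_succ, h, add_zero]) n

theorem succ_mul (m n : Omega M) : succ m * n = m * n + n :=
  ind (P := fun n => succ m * n = m * n + n) (by fun_prop)
    (by rw [mul_zero', mul_zero', add_zero])
    (fun n h => by rw [mul_succ, h, mul_succ, add_succ, add_succ]; congr 1; abel) n

theorem mul_comm' (m n : Omega M) : m * n = n * m :=
  ind (P := fun n => m * n = n * m) (by fun_prop) (by rw [mul_zero', zero_mul'])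
    (fun n h => by rw [mul_succ, succ_mul, h]) n

theorem left_distrib' (k m n : Omega M) : k * (m + n) = k * m + k * n :=
  ind (P := fun n => k * (m + n) = k * m + k * n) (by fun_prop)
    (by rw [mul_zero', add_zero, add_zero])
    (fun n h => by rw [add_succ, mul_succ, mul_succ, h, add_assoc]) n

theorem mul_assoc' (k m n : Omega M) : k * m * n = k * (m * n) :=
  ind (P := fun n => k * m * n = k * (m * n)) (by fun_prop) (by simp only [mul_zero'])
    (fun n h => by rw [mul_succ, mul_succ, h, left_distrib']) n

noncomputable instance : CommSemiring (Omega M) where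
  mul_assoc := mul_assoc'
  one_mul n := by rw [one_def, mul_comm', mul_succ, mul_zero', zero_add]
  mul_one n := by rw [one_def, mul_succ, mul_zero', zero_add]
  zero_mul := zero_mul'
  mul_zero := mul_zero'
  mul_comm := mul_comm'
  left_distrib := left_distrib'
  right_distrib k m n := by rw [mul_comm', left_distrib', mul_comm', mul_comm' n m]

theorem add_right_cancel' {k m n : Omega M} (h : m + k = n + k) : m = n := by
  revert h
  exact ind (P := fun k => m + k = n + k → m = n) (by fun_prop) (by simp)
    (fun k h h' => h (by simpa only [add_succ, succ_inj] using h')) k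

theorem eq_zero_or_succ (n : Omega M) : n = 0 ∨ ∃ m, n = m + 1 :=
  ind (P := fun n => n = 0 ∨ ∃ m, n = m + 1) (by fun_prop) (Or.inl rfl)
    (fun n _ => Or.inr ⟨n, succ_eq n⟩) n

theorem add_one_ne_zero (n : Omega M) : n + 1 ≠ 0 := succ_eq n ▸ succ_ne_zero n

theorem add_eq_zero {m n : Omega M} (h : m + n = 0) : m = 0 := by
  rcases eq_zero_or_succ m with rfl | ⟨k, rfl⟩
  · rfl
  · exact (add_one_ne_zero (k + n) (by rw [← h]; ring)).elim

theorem mul_eq_zero' {m n : Omega M} (h : m * n = 0) : m = 0 ∨ n = 0 := by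
  rcases eq_zero_or_succ m with rfl | ⟨k, rfl⟩
  · exact Or.inl rfl
  · exact Or.inr (add_eq_zero (n := k * n) (by rw [← h]; ring))

theorem total (m n : Omega M) : (∃ k, n = m + k) ∨ ∃ k, m = n + k :=
  ind (P := fun n => (∃ k, n = m + k) ∨ ∃ k, m = n + k) (by fun_prop)
    (Or.inr ⟨m, (zero_add m).symm⟩) (fun n h => by
      simp only [succ_eq]
      rcases h with ⟨k, rfl⟩ | ⟨k, rfl⟩
      · exact Or.inl ⟨k + 1, by ring⟩
      · rcases eq_zero_or_succ k with rfl | ⟨j, rfl⟩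
        · exact Or.inl ⟨1, by ring⟩
        · exact Or.inr ⟨j, by ring⟩) n

end Omega
end Omega
/-! ### Ordered fields -/

/-- A field is ordered by a cone. -/
theorem exists_linearOrder_of_cone {K : Type u} [Field K] (C : Set K)
    (add : ∀ x ∈ C, ∀ y ∈ C, x + y ∈ C) (mul : ∀ x ∈ C, ∀ y ∈ C, x * y ∈ C)
    (antisymm : ∀ x ∈ C, -x ∈ C → x = 0) (total : ∀ x, x ∈ C ∨ -x ∈ C) :
    ∃ _ : LinearOrder K, IsStrictOrderedRing K ∧ ∀ x : K, 0 ≤ x ↔ x ∈ C := by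
  classical
  have zero : (0 : K) ∈ C := by simpa using total 0
  have one : (1 : K) ∈ C := (total 1).elim (fun h => h) fun h => by simpa using mul _ h _ h
  let _ : LinearOrder K :=
    { le := fun a b => b - a ∈ C
      le_refl := fun a => by simpa using zero
      le_trans := fun a b c h h' => by simpa using add _ h _ h'
      le_antisymm := fun a b h h' => (sub_eq_zero.1 (antisymm _ h (by simpa using h'))).symm
      le_total := fun a b => by simpa using total (b - a)
      toDecidableLE := Classical.decRel _ }
  have le_iff : ∀ a b : K, a ≤ b ↔ b - a ∈ C := fun _ _ => Iff.rfl
  have : IsOrderedAddMonoid K :=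
    { add_le_add_left := fun a b h c => by simpa [le_iff] using h }
  have : ZeroLEOneClass K := ⟨by simpa [le_iff] using one⟩
  have : IsOrderedRing K := .of_mul_nonneg fun x y hx hy => by
    simp only [le_iff, sub_zero] at *
    exact mul _ hx _ hy
  exact ⟨inferInstance, inferInstance, fun x => by simp [le_iff]⟩

/-! ### Rings of differences and their fraction fields -/

section Differences

variable (N : Type u) [CommSemiring N] [IsCancelAdd N]

/-- Formal differences `a - b`, as numbers `a + b ω` with `ω = -1`. -/
def diffCon : RingCon (QuadraticAlgebra N 1 0) where
  r x y := x.re + y.im = y.re + x.im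
  iseqv :=
    { refl := fun _ => rfl
      symm := fun h => h.symm
      trans := fun {x y z} h h' => by
        apply add_right_cancel (b := y.re + y.im)
        linear_combination h + h' }
  add' {w x y z} h h' := by
    simp only [QuadraticAlgebra.re_add, QuadraticAlgebra.im_add] at *
    linear_combination h + h'
  mul' {w x y z} h h' := by
    simp only [QuadraticAlgebra.re_mul, QuadraticAlgebra.im_mul, one_mul, zero_mul, add_zero] at *
    -- Both products are compared with `x * y`; the added term is its `im` component.
    apply add_right_cancel (b := x.re * y.im + x.im * y.re)
    linear_combination (y.re) * h + (y.im) * h.symm + x.re * h' + x.im * h'.symm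

/-- The ring of differences. -/
abbrev DiffRing : Type u := (diffCon N).Quotient

variable {N}

theorem diffCon_iff {x y : QuadraticAlgebra N 1 0} :
    (x : DiffRing N) = y ↔ x.re + y.im = y.re + x.im := (diffCon N).eq

instance : Neg (DiffRing N) := ⟨fun x => ((⟨0, 1⟩ : QuadraticAlgebra N 1 0) : DiffRing N) * x⟩

instance : CommRing (DiffRing N) :=
  { (inferInstance : CommSemiring (DiffRing N)) with
    zsmul := zsmulRec
    neg_add_cancel := fun x => by
      obtain ⟨x, rfl⟩ := Quotient.exists_rep x
      change (((⟨0, 1⟩ : QuadraticAlgebra N 1 0) * x + x : QuadraticAlgebra N 1 0) : DiffRing N) =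
        (0 : QuadraticAlgebra N 1 0)
      rw [diffCon_iff]
      simp [add_comm] }

/-- The inclusion into the ring of differences. -/
def toDiff (N : Type u) [CommSemiring N] [IsCancelAdd N] : N →+* DiffRing N :=
  (diffCon N).mk'.comp (algebraMap N (QuadraticAlgebra N 1 0))

theorem toDiff_injective : Function.Injective (toDiff N) := fun a b h => by
  simpa using diffCon_iff.1 h

theorem exists_toDiff_sub (x : DiffRing N) : ∃ a b, x = toDiff N a - toDiff N b := by
  obtain ⟨x, rfl⟩ := Quotient.exists_rep x
  refine ⟨x.re, x.im, eq_sub_of_add_eq ?_⟩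
  change ((x + ⟨x.im, 0⟩ : QuadraticAlgebra N 1 0) : DiffRing N) =
    (⟨x.re, 0⟩ : QuadraticAlgebra N 1 0)
  rw [diffCon_iff]
  simp

/-- By `total` each difference is plus or minus an element of `N`, which excludes zero divisors. In
the fraction field the quotients of elements of `N` form a positive cone; `hz` makes it
antisymmetric. -/
theorem exists_fraction_field [Nontrivial N] [NoZeroDivisors N]
    (hz : ∀ m n : N, m + n = 0 → m = 0)
    (total : ∀ m n : N, (∃ k, n = m + k) ∨ ∃ k, m = n + k) :
    ∃ (K : Type u) (_ : Field K) (_ : LinearOrder K) (_ : IsStrictOrderedRing K) (i : N →+* K),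
      Function.Injective i ∧ (∀ n, 0 ≤ i n) ∧ ∀ x, ∃ a b c, c ≠ 0 ∧ x * i c = i a - i b := by
  have hpm (x : DiffRing N) : ∃ a, x = toDiff N a ∨ x = -toDiff N a := by
    obtain ⟨a, b, rfl⟩ := exists_toDiff_sub x
    rcases total a b with ⟨k, rfl⟩ | ⟨k, rfl⟩
    · exact ⟨k, Or.inr (by rw [map_add]; ring)⟩
    · exact ⟨k, Or.inl (by rw [map_add]; ring)⟩
  have : Nontrivial (DiffRing N) := toDiff_injective.nontrivial
  have : NoZeroDivisors (DiffRing N) := ⟨fun {x y} h => by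
    obtain ⟨a, ha⟩ := hpm x
    obtain ⟨b, hb⟩ := hpm y
    have h' : toDiff N (a * b) = 0 := by
      rw [map_mul]
      rcases ha with rfl | rfl <;> rcases hb with rfl | rfl <;> simpa using h
    rw [← map_zero (toDiff N)] at h'
    rcases mul_eq_zero.1 (toDiff_injective h') with rfl | rfl
    · left; simpa using ha
    · right; simpa using hb⟩
  have : IsDomain (DiffRing N) := NoZeroDivisors.to_isDomain _
  let K := FractionRing (DiffRing N)
  let i : N →+* K := (algebraMap (DiffRing N) K).comp (toDiff N)
  have hi : Function.Injective i := (IsFractionRing.injective _ _).comp toDiff_injective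
  have hi0 : ∀ n, n ≠ 0 → i n ≠ 0 := fun n hn h => hn (hi (by rw [h, map_zero]))
  have hrep (x : K) : ∃ a c, c ≠ 0 ∧ (x * i c = i a ∨ -x * i c = i a) := by
    obtain ⟨p, q, hq, rfl⟩ := IsFractionRing.div_surjective (A := DiffRing N) x
    obtain ⟨a, ha⟩ := hpm p
    obtain ⟨c, hc⟩ := hpm q
    have hq0 : q ≠ 0 := nonZeroDivisors.ne_zero hq
    have hc0 : c ≠ 0 := by rintro rfl; apply hq0; simpa using hc
    have := hi0 c hc0
    refine ⟨a, c, hc0, ?_⟩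
    change _ * algebraMap _ K (toDiff N c) = algebraMap _ K (toDiff N a) ∨
      _ * algebraMap _ K (toDiff N c) = algebraMap _ K (toDiff N a)
    change algebraMap _ K (toDiff N c) ≠ 0 at this
    rcases ha with rfl | rfl <;> rcases hc with rfl | rfl <;>
      simp only [map_neg, neg_div, div_neg, neg_mul, div_mul_cancel₀ _ this, neg_neg,
        true_or, or_true]
  obtain ⟨_, _, hC⟩ := exists_linearOrder_of_cone (K := K) {x | ∃ a c, c ≠ 0 ∧ x * i c = i a}
    (by
      rintro x ⟨a, c, hc, h⟩ y ⟨b, d, hd, h'⟩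
      exact ⟨a * d + b * c, c * d, mul_ne_zero hc hd, by
        simp only [map_mul, map_add]; linear_combination (i d) * h + (i c) * h'⟩)
    (by
      rintro x ⟨a, c, hc, h⟩ y ⟨b, d, hd, h'⟩
      exact ⟨a * b, c * d, mul_ne_zero hc hd, by
        simp only [map_mul]; linear_combination (y * i d) * h + i a * h'⟩)
    (by
      rintro x ⟨a, c, hc, h⟩ ⟨b, d, hd, h'⟩
      have : i (a * d + b * c) = 0 := by
        simp only [map_mul, map_add]; linear_combination - (i d) * h - (i c) * h'
      have := hz _ _ (hi (this.trans (map_zero i).symm))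
      rcases mul_eq_zero.1 this with rfl | h0
      · rw [map_zero] at h
        exact (mul_eq_zero.1 h).resolve_right (hi0 c hc)
      · exact (hd h0).elim)
    (fun x => by
      obtain ⟨a, c, hc, h | h⟩ := hrep x
      · exact Or.inl ⟨a, c, hc, h⟩
      · exact Or.inr ⟨a, c, hc, h⟩)
  refine ⟨K, inferInstance, _, ‹_›, i, hi, fun n => (hC _).2 ⟨n, 1, one_ne_zero, by simp⟩,
    fun x => ?_⟩
  obtain ⟨a, c, hc, h | h⟩ := hrep x
  · exact ⟨a, 0, c, hc, by rw [h, map_zero, sub_zero]⟩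
  · exact ⟨0, a, c, hc, by rw [← h, map_zero]; ring⟩

end Differences

/-! ### Completion of an ordered field -/

section Completion

open Filter

variable (K : Type u) [Field K] [LinearOrder K] [IsStrictOrderedRing K]

/-- An ultrafilter of positive elements that converges to zero. -/
noncomputable def smallUltra : Ultrafilter {e : K // 0 < e} :=
  have : Nonempty {e : K // 0 < e} := ⟨⟨1, one_pos⟩⟩
  Ultrafilter.of atBot

/-- The ultrapower. -/
abbrev UPow : Type u := (smallUltra K : Filter {e : K // 0 < e}).Germ K

/-- The diagonal embedding. -/
noncomputable def UPow.diag : K →+* UPow K :=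
  (Germ.coeRingHom (smallUltra K : Filter {e : K // 0 < e})).comp (Pi.constRingHom _ K)

variable {K}

open UPow

theorem UPow.diag_strictMono : StrictMono (diag K) := fun _ _ h => Germ.const_lt h

theorem UPow.diag_pos {e : K} (h : 0 < e) : 0 < diag K e := by
  simpa using diag_strictMono h

theorem UPow.diag_abs (q : K) : |diag K q| = diag K |q| := by
  rcases abs_cases q with ⟨h, h'⟩ | ⟨h, h'⟩
  · rw [h, abs_of_nonneg]; simpa using diag_strictMono.monotone h'
  · rw [h, abs_of_neg, map_neg]; simpa using diag_strictMono h'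

theorem smallUltra_le (e : {e : K // 0 < e}) : ∀ᶠ d in (smallUltra K : Filter _), d ≤ e := by
  have : Nonempty {e : K // 0 < e} := ⟨⟨1, one_pos⟩⟩
  exact Ultrafilter.of_le atBot (eventually_le_atBot e)

/-- `x` is approximated by elements of `K`. -/
def UPow.Near (x : UPow K) : Prop := ∀ e : K, 0 < e → ∃ q, |x - diag K q| < diag K e

theorem UPow.near_diag (q : K) : Near (diag K q) := fun e he => ⟨q, by simpa using diag_pos he⟩

theorem UPow.Near.bdd {x : UPow K} (h : Near x) : ∃ b : K, 0 < b ∧ |x| < diag K b := by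
  obtain ⟨q, hq⟩ := h 1 one_pos
  refine ⟨|q| + 1, by positivity, ?_⟩
  have := abs_sub_abs_le_abs_sub x (diag K q)
  rw [diag_abs] at this
  rw [map_add]
  linarith

theorem UPow.Near.add {x y : UPow K} (hx : Near x) (hy : Near y) : Near (x + y) := fun e he => by
  obtain ⟨p, hp⟩ := hx (e / 2) (by positivity)
  obtain ⟨q, hq⟩ := hy (e / 2) (by positivity)
  refine ⟨p + q, ?_⟩
  have h2 : diag K e = diag K (e / 2) + diag K (e / 2) := by rw [← map_add, add_halves]
  rw [h2, map_add, add_sub_add_comm]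
  exact (abs_add_le _ _).trans_lt (add_lt_add hp hq)

theorem UPow.Near.neg {x : UPow K} (hx : Near x) : Near (-x) := fun e he => by
  obtain ⟨p, hp⟩ := hx e he
  exact ⟨-p, by rwa [map_neg, ← neg_sub', abs_neg]⟩

theorem UPow.Near.mul {x y : UPow K} (hx : Near x) (hy : Near y) : Near (x * y) := fun e he => by
  obtain ⟨b, hb, hxb⟩ := hx.bdd
  -- The precision for `x` depends on the `q` chosen for `y`; in `|q| + 1` the summand 1 keeps the
  -- divisor positive when `q = 0`.
  obtain ⟨q, hq⟩ := hy (e / 2 / b) (by positivity)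
  obtain ⟨p, hp⟩ := hx (e / 2 / (|q| + 1)) (by positivity)
  refine ⟨p * q, ?_⟩
  have h2 : diag K e = diag K b * diag K (e / 2 / b) + diag K (e / 2 / (|q| + 1)) *
      diag K (|q| + 1) := by
    rw [← map_mul, ← map_mul, ← map_add]
    congr 1
    field_simp
    norm_num
  rw [h2, map_mul, show x * y - diag K p * diag K q =
    x * (y - diag K q) + (x - diag K p) * diag K q by ring]
  refine (abs_add_le _ _).trans_lt (add_lt_add_of_lt_of_le ?_ ?_)
  · rw [abs_mul]
    exact mul_lt_mul'' hxb hq (abs_nonneg _) (abs_nonneg _)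
  · rw [abs_mul, diag_abs]
    exact mul_le_mul hp.le (diag_strictMono.monotone (by linarith)) (diag_abs q ▸ abs_nonneg _)
      (diag_pos (by positivity)).le

theorem UPow.Near.inv {x : UPow K} (hx : Near x) {d : K} (hd : 0 < d) (h : diag K d ≤ |x|) :
    Near x⁻¹ := fun e he => by
  -- The first bound keeps `q` at distance at least `d / 2` from zero, and the second then controls
  -- the difference of the inverses.
  obtain ⟨q, hq⟩ := hx (min (d / 2) (e * (d * (d / 2)))) (by positivity)
  have hq1 : |x - diag K q| < diag K (d / 2) :=
    hq.trans_le (diag_strictMono.monotone (min_le_left _ _))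
  have hq2 : |x - diag K q| < diag K (e * (d * (d / 2))) :=
    hq.trans_le (diag_strictMono.monotone (min_le_right _ _))
  have h2 : diag K d = diag K (d / 2) + diag K (d / 2) := by rw [← map_add, add_halves]
  have hqd : diag K (d / 2) ≤ |diag K q| := by
    have := abs_sub_abs_le_abs_sub x (diag K q)
    linarith
  have hd' := diag_pos hd
  have hd2 : 0 < diag K (d / 2) := diag_pos (by positivity)
  have hx0 : x ≠ 0 := abs_pos.1 (hd'.trans_le h)
  have hq0 : diag K q ≠ 0 := abs_pos.1 (hd2.trans_le hqd)
  refine ⟨q⁻¹, ?_⟩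
  rw [map_inv₀, inv_sub_inv hx0 hq0, abs_div, div_lt_iff₀ (abs_pos.2 (mul_ne_zero hx0 hq0)),
    abs_sub_comm, abs_mul]
  refine hq2.trans_le ?_
  rw [map_mul, map_mul]
  have := diag_pos he
  gcongr

variable (K)

/-- The ring of the approximated elements. -/
noncomputable def nearRing : Subring (UPow K) where
  carrier := {x | Near x}
  mul_mem' := Near.mul
  one_mem' := by simpa using near_diag (1 : K)
  add_mem' := Near.add
  zero_mem' := by simpa using near_diag (0 : K)
  neg_mem' := Near.neg

/-- The ideal of the infinitesimal elements. -/
noncomputable def nearIdeal : Ideal (nearRing K) where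
  carrier := {x | ∀ e : K, 0 < e → |(x : UPow K)| < diag K e}
  zero_mem' := fun e he => by simpa using diag_pos he
  add_mem' {x y} hx hy e he := by
    have h2 : diag K e = diag K (e / 2) + diag K (e / 2) := by rw [← map_add, add_halves]
    rw [h2]
    exact (abs_add_le _ _).trans_lt (add_lt_add (hx _ (by positivity)) (hy _ (by positivity)))
  smul_mem' c x hx e he := by
    obtain ⟨b, hb, hcb⟩ := c.2.bdd
    have h2 : diag K e = diag K b * diag K (e / b) := by rw [← map_mul]; congr 1; field_simp
    change |(c : UPow K) * x| < _
    rw [h2, abs_mul]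
    exact mul_lt_mul'' hcb (hx _ (by positivity)) (abs_nonneg _) (abs_nonneg _)

theorem mem_nearIdeal {x : nearRing K} :
    x ∈ nearIdeal K ↔ ∀ e : K, 0 < e → |(x : UPow K)| < diag K e := Iff.rfl

/-- An approximated element that is not infinitesimal is bounded away from zero by an element of
`K`, hence its inverse is approximated as well. -/
instance : (nearIdeal K).IsMaximal := by
  refine Ideal.isMaximal_iff.2 ⟨fun h => ?_, fun J x hJ hx hxJ => ?_⟩
  · have := h 1 one_pos
    simp at this
  · rw [mem_nearIdeal] at hx
    push Not at hx
    obtain ⟨d, hd, h⟩ := hx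
    have hx0 : (x : UPow K) ≠ 0 := abs_pos.1 ((diag_pos hd).trans_le h)
    have := J.mul_mem_left ⟨(x : UPow K)⁻¹, x.2.inv hd h⟩ hxJ
    convert this
    exact Subtype.ext (inv_mul_cancel₀ hx0).symm

/-- The field is the quotient of the approximated elements of an ultrapower by the infinitesimals. A
cut whose gaps are arbitrarily small is realised by the germ that picks, for each `d`, an element of
`L` within `d` of the complement. -/
theorem exists_completion : ∃ (F : Type u) (_ : Field F) (_ : LinearOrder F)
    (_ : IsStrictOrderedRing F) (j : K →+* F), StrictMono j ∧
      (∀ x y, x < y → ∃ q, x < j q ∧ j q < y) ∧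
      ∀ L : Set K, (∀ p q, p < q → q ∈ L → p ∈ L) → (∀ e, 0 < e → ∃ q ∈ L, q + e ∉ L) →
        ∃ x, (∀ q ∈ L, j q ≤ x) ∧ ∀ q, q ∉ L → x ≤ j q := by
  obtain ⟨F, _, mk, mk_surj, mk_eq⟩ : ∃ (F : Type u) (_ : Field F) (mk : nearRing K →+* F),
      Function.Surjective mk ∧ ∀ {x}, mk x = 0 ↔ x ∈ nearIdeal K :=
    ⟨nearRing K ⧸ nearIdeal K, Ideal.Quotient.field _, Ideal.Quotient.mk _,
      Ideal.Quotient.mk_surjective, Ideal.Quotient.eq_zero_iff_mem⟩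
  obtain ⟨_, _, hC⟩ := exists_linearOrder_of_cone (K := F)
    {y | ∃ x : nearRing K, (0 : UPow K) ≤ x ∧ mk x = y}
    (by
      rintro _ ⟨x, hx, rfl⟩ _ ⟨y, hy, rfl⟩
      exact ⟨x + y, add_nonneg hx hy, map_add _ _ _⟩)
    (by
      rintro _ ⟨x, hx, rfl⟩ _ ⟨y, hy, rfl⟩
      exact ⟨x * y, mul_nonneg hx hy, map_mul _ _ _⟩)
    (by
      rintro _ ⟨x, hx, rfl⟩ ⟨y, hy, h⟩
      have : mk (x + y) = 0 := by rw [map_add, h, add_neg_cancel]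
      rw [mk_eq] at this ⊢
      intro e he
      have := this e he
      change |(x : UPow K) + y| < _ at this
      rw [abs_of_nonneg (add_nonneg hx hy)] at this
      rw [abs_of_nonneg hx]
      linarith)
    (fun y => by
      obtain ⟨x, rfl⟩ := mk_surj y
      rcases le_total (0 : UPow K) x with h | h
      · exact Or.inl ⟨x, h, rfl⟩
      · exact Or.inr ⟨-x, by simpa using h, map_neg _ _⟩)
  have mono {x y : nearRing K} (h : (x : UPow K) ≤ y) : mk x ≤ mk y := by
    rw [← sub_nonneg, hC]
    exact ⟨y - x, by simpa using h, map_sub _ _ _⟩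
  have le_of {x y : nearRing K} (h : ∀ e : K, 0 < e → (x : UPow K) ≤ y + diag K e) :
      mk x ≤ mk y := by
    rcases le_total (x : UPow K) y with hxy | hxy
    · exact mono hxy
    · refine le_of_eq (sub_eq_zero.1 ?_)
      rw [← map_sub, mk_eq]
      intro e he
      have h1 := h (e / 2) (by positivity)
      have h2 : diag K (e / 2) < diag K e := diag_strictMono (half_lt_self he)
      change |(x : UPow K) - y| < _
      rw [abs_of_nonneg (by simpa using hxy)]
      linarith
  have lt_of {x y : nearRing K} {e : K} (he : 0 < e) (h : (x : UPow K) + diag K e ≤ y) :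
      mk x < mk y := by
    have := diag_pos he
    refine lt_of_le_of_ne (mono (by linarith)) fun heq => ?_
    have h0 : mk (y - x) = 0 := by rw [map_sub, heq, sub_self]
    have h1 := mk_eq.1 h0 e he
    change |(y : UPow K) - x| < _ at h1
    rw [abs_of_nonneg (by linarith)] at h1
    linarith
  have of_lt {x y : nearRing K} (h : mk x < mk y) :
      ∃ e : K, 0 < e ∧ (x : UPow K) + diag K e ≤ y := by
    by_contra! hc
    exact h.not_ge (le_of fun e he => (hc e he).le)
  let j : K →+* F := mk.comp ((diag K).codRestrict (nearRing K) near_diag)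
  have hj (q : K) : j q = mk ⟨diag K q, near_diag q⟩ := rfl
  refine ⟨F, inferInstance, _, ‹_›, j, fun p q h => ?_, fun x y h => ?_, fun L hL hc => ?_⟩
  · refine lt_of (sub_pos.2 h) ?_
    change diag K p + diag K (q - p) ≤ diag K q
    rw [← map_add, add_sub_cancel]
  · obtain ⟨x, rfl⟩ := mk_surj x
    obtain ⟨y, rfl⟩ := mk_surj y
    obtain ⟨e, he, h⟩ := of_lt h
    -- Approximating `x + e / 2` up to `e / 4` leaves a margin of `e / 4` on either side.
    obtain ⟨q, hq⟩ := (x.2.add (near_diag (e / 2))) (e / 4) (by positivity)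
    have h2 : diag K (e / 2) = diag K (e / 4) + diag K (e / 4) := by
      rw [← map_add]; congr 1; ring
    have h4 : diag K e = diag K (e / 2) + diag K (e / 2) := by
      rw [← map_add]; congr 1; ring
    rw [abs_lt] at hq
    refine ⟨q, lt_of (e := e / 4) (by positivity) ?_, lt_of (e := e / 4) (by positivity) ?_⟩
    · change (x : UPow K) + diag K (e / 4) ≤ diag K q
      linarith
    · change diag K q + diag K (e / 4) ≤ y
      linarith
  · choose f hf hf' using fun e : {e : K // 0 < e} => hc e.1 e.2
    have hlt (p q : K) (hp : p ∈ L) (hq : q ∉ L) : p < q := by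
      by_contra! h
      rcases h.lt_or_eq with h | rfl
      · exact hq (hL _ _ h hp)
      · exact hq hp
    -- `f d` is always below `f (e / 2) + e / 2`, which is outside `L`; for `d ≤ e / 2` also `f (e /
    -- 2) < f d + d ≤ f d + e / 2`.
    have hx : Near (f : UPow K) := fun e he => by
      refine ⟨f ⟨e / 2, by positivity⟩, ?_⟩
      have h2 : diag K (e / 2) < diag K e := diag_strictMono (half_lt_self he)
      refine lt_of_le_of_lt (abs_sub_le_iff.2 ⟨?_, ?_⟩) h2
      · rw [sub_le_iff_le_add, ← map_add]
        refine Germ.coe_le.2 (Eventually.of_forall fun d => ?_)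
        have := hlt _ _ (hf d) (hf' ⟨e / 2, by positivity⟩)
        simpa [add_comm] using this.le
      · rw [sub_le_iff_le_add, ← sub_le_iff_le_add', ← map_sub]
        refine Germ.coe_le.2 ((smallUltra_le ⟨e / 2, by positivity⟩).mono fun d hd => ?_)
        have := hlt _ _ (hf ⟨e / 2, by positivity⟩) (hf' d)
        have hd : d.1 ≤ e / 2 := hd
        change _ - e / 2 ≤ f d
        linarith
    refine ⟨mk ⟨_, hx⟩, fun q hq => le_of fun e he => ?_, fun q hq => mono ?_⟩
    · change diag K q ≤ (f : UPow K) + diag K e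
      rw [← sub_le_iff_le_add, ← map_sub]
      refine Germ.coe_le.2 ((smallUltra_le ⟨e, he⟩).mono fun d hd => ?_)
      have := hlt _ _ hq (hf' d)
      have hd : d.1 ≤ e := hd
      change q - e ≤ f d
      linarith
    · exact Germ.coe_le.2 (Eventually.of_forall fun d => (hlt _ _ (hf d) hq).le)

end Completion
/-! ### The rational numbers of the model -/

section Rat

variable (M : Type u) [setLang.Structure M] [IsZFModel M]

/-- A triple `(a, b, n)` stands for the fraction `(a - b) / (n + 1)`. -/
abbrev Triple : Type u := Omega M × Omega M × Omega M

/-- The last clause is the Archimedean property as the model sees it: it comes from induction in the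
model and is therefore claimed for definable `L` only. -/
theorem exists_rationals : ∃ (K : Type u) (_ : Field K) (_ : LinearOrder K)
    (_ : IsStrictOrderedRing K) (_ : Coded M K), Small M K ∧
      (Dfn M fun p : K × K => p.1 + p.2) ∧ (Dfn M fun p : K × K => p.1 * p.2) ∧
      (Dfn M fun p : K × K => p.1 ≤ p.2) ∧
      ∀ L : Set K, (Dfn M fun q => q ∈ L) → (∀ p q, p < q → q ∈ L → p ∈ L) → L.Nonempty →
        (∃ q, q ∉ L) → ∀ e, 0 < e → ∃ q ∈ L, q + e ∉ L := by
  have : IsCancelAdd (Omega M) :=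
    { add_left_cancel := fun k m n h => Omega.add_right_cancel' (k := k) (by
        simpa only [add_comm k] using h)
      add_right_cancel := fun k m n h => Omega.add_right_cancel' h }
  have : Nontrivial (Omega M) := ⟨0 + 1, 0, Omega.add_one_ne_zero 0⟩
  have : NoZeroDivisors (Omega M) := ⟨Omega.mul_eq_zero'⟩
  obtain ⟨K, _, _, _, i, hi, hi0, hrep⟩ := exists_fraction_field (N := Omega M)
    (fun _ _ => Omega.add_eq_zero) Omega.total
  have hpos (n : Omega M) : 0 < i n + 1 := by linarith [hi0 n]
  have hne (n : Omega M) : i n + 1 ≠ 0 := (hpos n).ne'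
  have hle (m n : Omega M) : i m ≤ i n ↔ ∃ k, n = m + k := by
    constructor
    · intro h
      rcases Omega.total m n with hk | ⟨k, rfl⟩
      · exact hk
      · rw [map_add] at h
        have : i k = 0 := le_antisymm (by linarith) (hi0 k)
        rw [← map_zero i] at this
        exact ⟨0, by rw [hi this]; simp⟩
    · rintro ⟨k, rfl⟩
      rw [map_add]
      linarith [hi0 k]
  let π : Triple M → K := fun t => (i t.1 - i t.2.1) / (i t.2.2 + 1)
  have hs : Function.Surjective π := fun x => by
    obtain ⟨a, b, c, hc, h⟩ := hrep x
    obtain ⟨n, rfl⟩ := (Omega.eq_zero_or_succ c).resolve_left hc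
    refine ⟨(a, b, n), ?_⟩
    simp only [π, ← h, map_add, map_one]
    field_simp [hne n]
  -- Cross-multiplied and with an explicit difference `k`, the order becomes an equation in natural
  -- numbers, which makes it definable.
  have hπle (s t : Triple M) : π s ≤ π t ↔ ∃ k,
      t.1 * (s.2.2 + 1) + s.2.1 * (t.2.2 + 1) = s.1 * (t.2.2 + 1) +
        t.2.1 * (s.2.2 + 1) + k := by
    rw [← hle, div_le_div_iff₀ (hpos _) (hpos _)]
    simp only [map_add, map_mul, map_one]
    constructor <;> intro h <;> linarith
  have hled : Dfn M fun p : Triple M × Triple M => π p.1 ≤ π p.2 := by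
    simp only [hπle]
    fun_prop
  have hk : Dfn M fun p : Triple M × Triple M => π p.1 = π p.2 := by
    refine (hled.and (hled.comp (f := fun p : Triple M × Triple M => (p.2, p.1))
      (by fun_prop))).pred_congr ?_
    exact fun _ => le_antisymm_iff
  let _ : Coded M K := Coded.ofSurjective hs hk
  have hc : ∀ c, (code (fibre hs hk c) : M) = code c := fun _ => rfl
  have hπ : Dfn M π := dfn_of_code_fibre hs hk hc
  have hadd : Dfn M fun p : K × K => p.1 + p.2 := by
    refine Dfn.of_surjective₂ hπ hs (f := fun x y => x + y) ?_
    have e : ∀ p : Triple M × Triple M, π p.1 + π p.2 = π (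
        p.1.1 * (p.2.2.2 + 1) + p.2.1 * (p.1.2.2 + 1),
        p.1.2.1 * (p.2.2.2 + 1) + p.2.2.1 * (p.1.2.2 + 1),
        p.1.2.2 * p.2.2.2 + p.1.2.2 + p.2.2.2) := by
      intro p
      have e : i p.1.2.2 * i p.2.2.2 + i p.1.2.2 + i p.2.2.2 + 1 =
        (i p.1.2.2 + 1) * (i p.2.2.2 + 1) := by ring
      simp only [π, map_add, map_mul, map_one, e]
      rw [div_add_div _ _ (hne _) (hne _)]
      ring
    simp only [e]
    fun_prop
  have hmul : Dfn M fun p : K × K => p.1 * p.2 := by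
    refine Dfn.of_surjective₂ hπ hs (f := fun x y => x * y) ?_
    have e : ∀ p : Triple M × Triple M, π p.1 * π p.2 = π (
        p.1.1 * p.2.1 + p.1.2.1 * p.2.2.1,
        p.1.1 * p.2.2.1 + p.1.2.1 * p.2.1,
        p.1.2.2 * p.2.2.2 + p.1.2.2 + p.2.2.2) := by
      intro p
      have e : i p.1.2.2 * i p.2.2.2 + i p.1.2.2 + i p.2.2.2 + 1 =
        (i p.1.2.2 + 1) * (i p.2.2.2 + 1) := by ring
      simp only [π, map_add, map_mul, e]
      rw [div_mul_div_comm]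
      ring
    simp only [e]
    fun_prop
  refine ⟨K, inferInstance, _, inferInstance, _, Small.of_code_eq hc, hadd, hmul,
    Dfn.of_surjective₂ hπ hs (f := fun x y => x ≤ y) hled, ?_⟩
  rintro L hL hlow ⟨q, hq⟩ ⟨b, hb⟩ e he
  by_contra! hcon
  have hi' : Dfn M i := by
    have e : ∀ n, i n = π (n, 0, 0) := fun n => by simp [π]
    have e' : (i : Omega M → K) = fun n => π (n, 0, 0) := funext e
    rw [e']
    fun_prop
  have hd : Dfn M fun n : Omega M => q + i n * e ∈ L :=
    hL.comp (hadd.comp (.mk (.const q) (hmul.comp (.mk hi' (.const e)))))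
  -- If no step of length `e` ever leaves `L`, then `L` contains all `q + n e`; but these pass `b`.
  have hall := Omega.ind hd (by simpa using hq) fun n hn => by
    have := hcon _ hn
    rwa [Omega.succ_eq, map_add, map_one, add_one_mul, ← add_assoc]
  obtain ⟨x, y, c, hc, h⟩ := hrep ((b - q) / e)
  obtain ⟨n, rfl⟩ := (Omega.eq_zero_or_succ c).resolve_left hc
  -- The denominator is at least 1, so the numerator `x` alone bounds the fraction.
  have hx : b ≤ q + i x * e := by
    have h1 : (b - q) / e ≤ i x := by
      by_contra! h1
      have := hi0 n
      have := hi0 x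
      have := hi0 y
      rw [map_add, map_one] at h
      nlinarith
    rw [div_le_iff₀ he] at h1
    linarith
  rcases hx.lt_or_eq with h1 | h1
  · exact hb (hlow _ _ h1 (hall x))
  · exact hb (h1 ▸ hall x)

end Rat
/-! ### The real line of the model -/

section Cut

variable {K F : Type u} [Field K] [LinearOrder K] [IsStrictOrderedRing K] [Field F] [LinearOrder F]
  [IsStrictOrderedRing F] {j : K →+* F}

open Topology Filter in
/-- The lower cut of a value of a continuous operation. -/
theorem lt_op_iff [TopologicalSpace F] [OrderTopology F] (hj : StrictMono j)
    (hd : ∀ x y, x < y → ∃ q, x < j q ∧ j q < y) {g : F → F → F} {k : K → K → K}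
    (hg : ∀ p q, j (k p q) = g (j p) (j q)) {x y : F}
    (hc : ContinuousAt (fun p : F × F => g p.1 p.2) (x, y)) (q : K) :
    j q < g x y ↔ ∃ q', q < q' ∧ ∃ r₁ r₂ s₁ s₂, j r₁ < x ∧ ¬ j r₂ ≤ x ∧ j s₁ < y ∧ ¬ j s₂ ≤ y ∧
      ∀ r s, r₁ < r → r < r₂ → s₁ < s → s < s₂ → q' ≤ k r s := by
  -- Continuity gives an open box around `(x, y)`, and density shrinks it to corners in `K`.
  have key (U : Set F) (hU : U ∈ 𝓝 (g x y)) : ∃ r₁ r₂ s₁ s₂, j r₁ < x ∧ x < j r₂ ∧ j s₁ < y ∧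
      y < j s₂ ∧ ∀ r s, r₁ < r → r < r₂ → s₁ < s → s < s₂ → g (j r) (j s) ∈ U := by
    have h := hc hU
    rw [mem_map, nhds_prod_eq, mem_prod_iff] at h
    obtain ⟨A, hA, B, hB, hAB⟩ := h
    obtain ⟨a, b, ⟨ha, hb⟩, hA⟩ := mem_nhds_iff_exists_Ioo_subset.1 hA
    obtain ⟨c, d, ⟨hc, hd'⟩, hB⟩ := mem_nhds_iff_exists_Ioo_subset.1 hB
    obtain ⟨r₁, h1, h1'⟩ := hd _ _ ha
    obtain ⟨r₂, h2, h2'⟩ := hd _ _ hb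
    obtain ⟨s₁, h3, h3'⟩ := hd _ _ hc
    obtain ⟨s₂, h4, h4'⟩ := hd _ _ hd'
    refine ⟨r₁, r₂, s₁, s₂, h1', h2, h3', h4, fun r s hr hr' hs hs' => ?_⟩
    exact hAB (Set.mk_mem_prod (hA ⟨h1.trans (hj hr), (hj hr').trans h2'⟩)
      (hB ⟨h3.trans (hj hs), (hj hs').trans h4'⟩))
  simp only [not_le]
  constructor
  · intro h
    obtain ⟨q', h1, h2⟩ := hd _ _ h
    obtain ⟨r₁, r₂, s₁, s₂, hr, hr', hs, hs', H⟩ := key _ (Ioi_mem_nhds h2)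
    refine ⟨q', hj.lt_iff_lt.1 h1, r₁, r₂, s₁, s₂, hr, hr', hs, hs', fun r s a b c d => ?_⟩
    have := H r s a b c d
    rw [← hg] at this
    exact (hj.lt_iff_lt.1 this).le
  · rintro ⟨q', hq, r₁, r₂, s₁, s₂, hr, hr', hs, hs', H⟩
    by_contra! hcon
    -- Otherwise `k` stays below `q'` on another box around `(x, y)`. A point of `K` common to both
    -- boxes gives the contradiction.
    obtain ⟨t₁, t₂, u₁, u₂, ht, ht', hu, hu', H'⟩ :=
      key _ (Iio_mem_nhds (hcon.trans_lt (hj hq)))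
    obtain ⟨r, h1, h2⟩ := hd (max (j r₁) (j t₁)) (min (j r₂) (j t₂))
      (by simp only [max_lt_iff, lt_min_iff]; exact
        ⟨⟨hr.trans hr', ht.trans hr'⟩, hr.trans ht', ht.trans ht'⟩)
    obtain ⟨s, h3, h4⟩ := hd (max (j s₁) (j u₁)) (min (j s₂) (j u₂))
      (by simp only [max_lt_iff, lt_min_iff]; exact
        ⟨⟨hs.trans hs', hu.trans hs'⟩, hs.trans hu', hu.trans hu'⟩)
    simp only [max_lt_iff, lt_min_iff, hj.lt_iff_lt] at h1 h2 h3 h4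
    have h5 := H r s h1.1 h2.1 h3.1 h4.1
    have h6 := H' r s h1.2 h2.2 h3.2 h4.2
    rw [← hg] at h6
    exact (hj.lt_iff_lt.1 h6).not_ge h5

end Cut

section Real

variable (M : Type u) [setLang.Structure M] [IsZFModel M]

/-- Elements of the completion `F` whose lower cut in `K` is definable form a subfield, since the
cut of a value of a continuous operation is first-order in the cuts of the arguments. The cuts serve
as codes. -/
theorem exists_reals : ∃ (T : Type u) (_ : Field T) (_ : LinearOrder T)
    (_ : IsStrictOrderedRing T) (_ : Coded M T), Small M T ∧
      (Dfn M fun p : T × T => p.1 + p.2) ∧ (Dfn M fun p : T × T => p.1 * p.2) ∧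
      (Dfn M fun p : T × T => p.1 ≤ p.2) ∧
      ∀ S : Set T, (Dfn M fun q => q ∈ S) → S.Nonempty → BddAbove S → ∃ s, IsLUB S s := by
  obtain ⟨K, _, _, _, _, _, hadd, hmul, hle, harch⟩ := exists_rationals M
  obtain ⟨F, _, _, _, j, hj, hd, hcomp⟩ := exists_completion K
  let _ : TopologicalSpace F := Preorder.topology F
  have : OrderTopology F := ⟨rfl⟩
  have hlt : Dfn M fun p : K × K => p.1 < p.2 :=
    (hle.comp (f := fun p : K × K => (p.2, p.1)) (by fun_prop)).not.pred_congr fun p => by simp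
  obtain ⟨le', hle'⟩ : ∃ f : K × K → Prop, ∀ p q, p ≤ q ↔ f (p, q) :=
    ⟨fun p => p.1 ≤ p.2, fun _ _ => Iff.rfl⟩
  obtain ⟨lt', hlt'⟩ : ∃ f : K × K → Prop, ∀ p q, p < q ↔ f (p, q) :=
    ⟨fun p => p.1 < p.2, fun _ _ => Iff.rfl⟩
  replace hle : Dfn M le' := hle.pred_congr fun p => (hle' _ _).symm
  replace hlt : Dfn M lt' := hlt.pred_congr fun p => (hlt' _ _).symm
  let P (x : F) : Prop := Dfn M fun q : K => j q < x
  have hcut (x y : F) (h : ∀ q, j q < x ↔ j q < y) : x = y := by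
    by_contra hne
    rcases lt_or_gt_of_ne hne with hlt | hlt <;> obtain ⟨q, h1, h2⟩ := hd _ _ hlt
    · exact h1.not_gt ((h q).2 h2)
    · exact h1.not_gt ((h q).1 h2)
  -- Non-strict comparison, too, has to be read off from the strict lower cut.
  have hge {x : F} (r : K) : j r ≤ x ↔ ∀ q, q < r → j q < x := by
    refine ⟨fun h q hq => (hj hq).trans_le h, fun h => ?_⟩
    by_contra! hx
    obtain ⟨q, h1, h2⟩ := hd _ _ hx
    exact h1.not_gt (h q (hj.lt_iff_lt.1 h2))
  have hPop {g : F → F → F} {k : K → K → K} (hg : ∀ p q, j (k p q) = g (j p) (j q))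
      (hk : Dfn M fun p : K × K => k p.1 p.2) {x y : F} (hx : P x) (hy : P y)
      (hc : ContinuousAt (fun p : F × F => g p.1 p.2) (x, y)) : P (g x y) := by
    obtain ⟨k', hk'⟩ : ∃ f : K × K → K, ∀ p q, k p q = f (p, q) :=
      ⟨fun p => k p.1 p.2, fun _ _ => rfl⟩
    replace hk : Dfn M k' := by convert hk using 2 with p; exact (hk' _ _).symm
    obtain ⟨X, hX⟩ : ∃ f : K → Prop, ∀ q, j q < x ↔ f q := ⟨_, fun _ => Iff.rfl⟩
    obtain ⟨Y, hY⟩ : ∃ f : K → Prop, ∀ q, j q < y ↔ f q := ⟨_, fun _ => Iff.rfl⟩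
    replace hx : Dfn M X := hx.pred_congr fun p => (hX _).symm
    replace hy : Dfn M Y := hy.pred_congr fun p => (hY _).symm
    refine Dfn.pred_congr ?_ (lt_op_iff hj hd hg hc)
    simp only [hge, hX, hY, hk', hle', hlt']
    fun_prop
  have hPj (r : K) : P (j r) := by
    refine Dfn.pred_congr (P := fun q => lt' (q, r)) (by fun_prop) fun q => ?_
    rw [hj.lt_iff_lt, hlt']
  have hPadd {x y : F} (hx : P x) (hy : P y) : P (x + y) :=
    hPop (map_add j) hadd hx hy (by fun_prop)
  have hPmul {x y : F} (hx : P x) (hy : P y) : P (x * y) :=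
    hPop (map_mul j) hmul hx hy (by fun_prop)
  have hPneg {x : F} (hx : P x) : P (-x) := by
    have := hPmul (hPj (-1)) hx
    simpa using this
  have hPinv {x : F} (hx : P x) : P x⁻¹ := by
    rcases eq_or_ne x 0 with rfl | h0
    · simpa using hx
    -- Inversion is treated as a binary operation that ignores its second argument.
    · refine hPop (g := fun x _ => x⁻¹) (k := fun x _ => x⁻¹) (fun p _ => map_inv₀ j p) ?_ hx hx ?_
      · obtain ⟨k', hk'⟩ : ∃ f : K × K → K, ∀ p q, p * q = f (p, q) :=
          ⟨fun p => p.1 * p.2, fun _ _ => rfl⟩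
        have hk : Dfn M k' := by convert hmul using 2 with p; exact (hk' _ _).symm
        have : Dfn M fun p : K => p⁻¹ := by
          refine Dfn.of_graph (R := fun p q => p = 0 ∧ q = 0 ∨ k' (p, q) = 1) (by fun_prop)
            fun p q => ?_
          rw [← hk']
          rcases eq_or_ne p 0 with rfl | h
          · simp
          · simp only [h, false_and, false_or]
            exact ⟨eq_inv_of_mul_eq_one_right, fun e => e ▸ mul_inv_cancel₀ h⟩
        exact this.comp Dfn.fst
      · exact ContinuousAt.inv₀ (by fun_prop) h0
  let S : Subfield F :=
    { carrier := {x | P x}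
      mul_mem' := hPmul
      one_mem' := by simpa using hPj 1
      add_mem' := hPadd
      zero_mem' := by simpa using hPj 0
      neg_mem' := hPneg
      inv_mem' := fun _ => hPinv }
  let cut (x : S) : ISet M K := ⟨{q | j q < x}, x.2⟩
  have mem_cut (x : S) (q : K) : j q < x ↔ q ∈ cut x := Iff.rfl
  have hcuti : Function.Injective cut := fun x y h =>
    Subtype.ext (hcut _ _ fun q => by rw [mem_cut, h, mem_cut])
  have hreal (C : Set K) (hC : Dfn M fun q => q ∈ C) (h0 : C.Nonempty) (h1 : ∃ q, q ∉ C)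
      (hl : ∀ p q, p < q → q ∈ C → p ∈ C) (hm : ∀ q ∈ C, ∃ p ∈ C, q < p) :
      ∃ x : S, ∀ q, j q < x ↔ q ∈ C := by
    obtain ⟨x, hx, hx'⟩ := hcomp C hl (harch C hC hl h0 h1)
    have hxC (q : K) : j q < x ↔ q ∈ C := by
      constructor
      · intro h
        by_contra hq
        exact (hx' q hq).not_gt h
      · intro h
        obtain ⟨p, hp, hqp⟩ := hm q h
        exact (hj hqp).trans_le (hx p hp)
    exact ⟨⟨x, hC.pred_congr hxC⟩, hxC⟩
  have hrange : Dfn M fun C : ISet M K => ∃ x, cut x = C := by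
    -- The codes are the nonempty proper lower sets without a greatest element.
    refine Dfn.pred_congr (P := fun C : ISet M K => (∃ q, q ∈ C) ∧ (∃ q, ¬ q ∈ C) ∧
      (∀ p q, lt' (p, q) → q ∈ C → p ∈ C) ∧ ∀ q, q ∈ C → ∃ p, p ∈ C ∧ lt' (q, p))
      (by fun_prop) fun C => ?_
    simp only [← hlt']
    constructor
    · rintro ⟨x, rfl⟩
      obtain ⟨q, -, hq⟩ := hd (x - 1) x (by simp)
      obtain ⟨p, hp, -⟩ := hd x (x + 1) (by simp)
      refine ⟨⟨q, hq⟩, ⟨p, hp.not_gt⟩, fun p q h h' => (hj h).trans h', fun q h => ?_⟩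
      obtain ⟨p, hp, hp'⟩ := hd _ _ h
      exact ⟨p, hp', hj.lt_iff_lt.1 hp⟩
    · rintro ⟨h0, h1, hl, hm⟩
      obtain ⟨x, hx⟩ := hreal C C.dfn_mem h0 h1 hl hm
      exact ⟨x, SetLike.ext hx⟩
  let _ : Coded M S := Coded.ofInjective M cut hcuti hrange
  have hc : ∀ x, (code (cut x) : M) = code x := fun _ => rfl
  have hcutd : Dfn M cut := Dfn.of_code_eq hc
  have hop {g : F → F → F} {k : K → K → K} (hg : ∀ p q, j (k p q) = g (j p) (j q))
      (hk : Dfn M fun p : K × K => k p.1 p.2)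
      (hc : ∀ x y, ContinuousAt (fun p : F × F => g p.1 p.2) (x, y))
      {f : S → S → S} (hf : ∀ x y, (f x y : F) = g x y) : Dfn M fun p : S × S => f p.1 p.2 := by
    obtain ⟨k', hk'⟩ : ∃ f : K × K → K, ∀ p q, k p q = f (p, q) :=
      ⟨fun p => k p.1 p.2, fun _ _ => rfl⟩
    replace hk : Dfn M k' := by convert hk using 2 with p; exact (hk' _ _).symm
    refine Dfn.of_graph (R := fun p z => ∀ q, q ∈ cut z ↔ j q < g p.1 p.2) ?_ fun p z => ?_
    · simp only [lt_op_iff hj hd hg (hc _ _), hge, mem_cut, hk', hle', hlt']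
      fun_prop
    · rw [← hf]
      exact SetLike.ext_iff.symm.trans hcuti.eq_iff
  refine ⟨S, inferInstance, inferInstance, inferInstance, _, Small.of_code_eq hc,
    hop (map_add j) hadd (fun x y => by fun_prop) fun _ _ => rfl,
    hop (map_mul j) hmul (fun x y => by fun_prop) fun _ _ => rfl, ?_, fun A hA h0 hb => ?_⟩
  · refine Dfn.pred_congr (P := fun p : S × S => ∀ q, q ∈ cut p.1 → q ∈ cut p.2) (by fun_prop)
      fun p => ⟨fun h q hq => lt_of_lt_of_le hq h, fun h => ?_⟩
    by_contra! hlt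
    obtain ⟨q, h1, h2⟩ := hd _ _ (show (p.2 : F) < p.1 from hlt)
    exact h1.not_gt (h q h2)
  · obtain ⟨a, ha⟩ := h0
    obtain ⟨b, hb⟩ := hb
    obtain ⟨B, hB⟩ : ∃ B : S → Prop, ∀ x, x ∈ A ↔ B x := ⟨_, fun _ => Iff.rfl⟩
    replace hA : Dfn M B := hA.pred_congr fun x => (hB x).symm
    -- The cut of the supremum is the union of the cuts of the members.
    obtain ⟨s, hs⟩ := hreal {q | ∃ x, x ∈ A ∧ j q < x}
      (by simp only [Set.mem_ofPred_eq, hB, mem_cut]; fun_prop)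
      (by
        obtain ⟨q, -, hq⟩ := hd ((a : F) - 1) a (by simp)
        exact ⟨q, a, ha, hq⟩)
      (by
        obtain ⟨q, hq, -⟩ := hd (b : F) (b + 1) (by simp)
        refine ⟨q, ?_⟩
        rintro ⟨x, hx, hqx⟩
        exact (hq.trans hqx).not_ge (hb hx))
      (by
        rintro p q h ⟨x, hx, hqx⟩
        exact ⟨x, hx, (hj h).trans hqx⟩)
      (by
        rintro q ⟨x, hx, hqx⟩
        obtain ⟨p, h1, h2⟩ := hd _ _ hqx
        exact ⟨p, ⟨x, hx, h2⟩, hj.lt_iff_lt.1 h1⟩)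
    refine ⟨s, fun x hx => ?_, fun c hc => ?_⟩
    · by_contra! h
      obtain ⟨q, h1, h2⟩ := hd _ _ (show (s : F) < x from h)
      exact h1.not_gt ((hs q).2 ⟨x, hx, h2⟩)
    · by_contra! h
      obtain ⟨q, h1, h2⟩ := hd _ _ (show (c : F) < s from h)
      obtain ⟨x, hx, h3⟩ := (hs q).1 h2
      exact (h1.trans h3).not_ge (hc hx)

/-- A coded type whose elements form a set of the model is a type of members. -/
theorem exists_elt_equiv {M : Type u} [setLang.Structure M] [IsZFModel M] (α : Type v) [Coded M α]
    [Small M α] : ∃ (A : M) (e : Elt A ≃ α), Dfn M e ∧ Dfn M e.symm := by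
  obtain ⟨A, hA⟩ := Small.exists_range (M := M) (α := α)
  let f (a : α) : Elt A := ⟨code a, (hA _).2 ⟨a, rfl⟩⟩
  have hf : Function.Bijective f :=
    ⟨fun a b h => Coded.code_injective (congrArg Subtype.val h), fun x => by
      obtain ⟨a, ha⟩ := (hA _).1 x.2
      exact ⟨a, Subtype.ext ha⟩⟩
  have hfd : Dfn M f := Dfn.to_elt (f := f) Dfn.code_fun
  let e := (Equiv.ofBijective f hf).symm
  refine ⟨A, e, Dfn.of_graph (R := fun x a => f a = x) (by fun_prop) fun x a => ?_, hfd⟩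
  exact (Equiv.eq_symm_apply (Equiv.ofBijective f hf)).symm

theorem exists_realLine : ∃ R : M, Nonempty (RealLine R) := by
  obtain ⟨T, _, _, _, _, _, hadd, hmul, hle, hcomp⟩ := exists_reals M
  obtain ⟨R, e, he, he'⟩ := exists_elt_equiv (M := M) T
  let fR : Field (Elt R) := e.field
  let lR : LinearOrder (Elt R) := LinearOrder.lift' e e.injective
  have hs : IsStrictOrderedRing (Elt R) :=
    Function.Injective.isStrictOrderedRing e (e.apply_symm_apply 0) (e.apply_symm_apply 1)
      (fun _ _ => e.apply_symm_apply _) (fun _ _ => e.apply_symm_apply _) Iff.rfl Iff.rfl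
  refine ⟨R, ⟨{ fR, lR, hs with
    internal_add := ?_
    internal_mul := ?_
    internal_le := ?_
    complete := fun S hS h0 hb => ?_ }⟩⟩
  · exact internal₂_iff.2 (he'.comp (hadd.comp (f := fun p : Elt R × Elt R => (e p.1, e p.2))
      (by fun_prop)))
  · exact internal₂_iff.2 (he'.comp (hmul.comp (f := fun p : Elt R × Elt R => (e p.1, e p.2))
      (by fun_prop)))
  · exact internalRel_iff.2 (hle.comp (f := fun p : Elt R × Elt R => (e p.1, e p.2))
      (by fun_prop))
  · obtain ⟨s, hs⟩ := hcomp {x | e.symm x ∈ S} ((internalSet_iff.1 hS).comp he')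
      (by obtain ⟨x, hx⟩ := h0; exact ⟨e x, by simpa using hx⟩)
      (by
        obtain ⟨b, hb⟩ := hb
        exact ⟨e b, fun x hx => by simpa using (show e (e.symm x) ≤ e b from hb hx)⟩)
    refine ⟨e.symm s, fun x hx => ?_, fun b hb => ?_⟩
    · change e x ≤ e (e.symm s)
      rw [e.apply_symm_apply]
      exact hs.1 (by simpa using hx)
    · change e (e.symm s) ≤ e b
      rw [e.apply_symm_apply]
      exact hs.2 fun x hx => by simpa using (show e (e.symm x) ≤ e b from hb hx)

end Real
/-! ### Definability of the operations of the real line, of normed spaces and of their duals -/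

section Spaces

variable {M : Type u} [setLang.Structure M] [IsZFModel M] {α : Type v} [Coded M α]
  {R V : M} [RealLine R]

@[fun_prop]
theorem Dfn.real_add {f g : α → Elt R} (hf : Dfn M f) (hg : Dfn M g) :
    Dfn M fun a => f a + g a :=
  (internal₂_iff.1 (RealLine.internal_add (R := R))).comp (hf.mk hg)

@[fun_prop]
theorem Dfn.real_mul {f g : α → Elt R} (hf : Dfn M f) (hg : Dfn M g) :
    Dfn M fun a => f a * g a :=
  (internal₂_iff.1 (RealLine.internal_mul (R := R))).comp (hf.mk hg)

@[fun_prop]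
theorem Dfn.real_le {f g : α → Elt R} (hf : Dfn M f) (hg : Dfn M g) :
    Dfn M fun a => f a ≤ g a :=
  (internalRel_iff.1 (RealLine.internal_le (R := R))).comp (hf.mk hg)

@[fun_prop]
theorem Dfn.real_lt {f g : α → Elt R} (hf : Dfn M f) (hg : Dfn M g) :
    Dfn M fun a => f a < g a :=
  (hg.real_le hf).not.pred_congr fun _ => not_le.symm

@[fun_prop]
theorem Dfn.real_sub {f g : α → Elt R} (hf : Dfn M f) (hg : Dfn M g) :
    Dfn M fun a => f a - g a :=
  Dfn.of_graph (R := fun a z => z + g a = f a) (by fun_prop) fun _ _ => eq_sub_iff_add_eq.symm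

@[fun_prop]
theorem Dfn.real_abs {f : α → Elt R} (hf : Dfn M f) : Dfn M fun a => |f a| :=
  Dfn.of_graph (R := fun a z => 0 ≤ f a ∧ z = f a ∨ f a < 0 ∧ z = 0 - f a) (by fun_prop)
    fun a z => by
      rcases le_or_gt 0 (f a) with h | h
      · simp [h, h.not_gt, abs_of_nonneg]
      · simp [h, h.not_ge, abs_of_neg]

variable [NSpace R V]

@[fun_prop]
theorem Dfn.vec_add {f g : α → Elt V} (hf : Dfn M f) (hg : Dfn M g) :
    Dfn M fun a => f a + g a :=
  (internal₂_iff.1 (NSpace.internal_add (R := R) (V := V))).comp (hf.mk hg)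

@[fun_prop]
theorem Dfn.vec_smul {f : α → Elt R} {g : α → Elt V} (hf : Dfn M f) (hg : Dfn M g) :
    Dfn M fun a => f a • g a :=
  (internal₂_iff.1 (NSpace.internal_smul (R := R) (V := V))).comp (hf.mk hg)

@[fun_prop]
theorem Dfn.vec_nrm {f : α → Elt V} (hf : Dfn M f) :
    Dfn M fun a => NSpace.nrm (R := R) (f a) :=
  (internal_iff.1 (NSpace.internal_nrm (R := R) (V := V))).comp hf

@[fun_prop]
theorem Dfn.vec_sub {f g : α → Elt V} (hf : Dfn M f) (hg : Dfn M g) :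
    Dfn M fun a => f a - g a :=
  Dfn.of_graph (R := fun a z => z + g a = f a) (.eq (hf := Dfn.vec_add (R := R) (by fun_prop)
    (by fun_prop)) (by fun_prop)) fun _ _ => eq_sub_iff_add_eq.symm

/-- The graph of a functional. -/
def Dual.toIFun (φ : Dual R V) : IFun M (Elt V) (Elt R) := ⟨φ.toFun, internal_iff.1 φ.internal⟩

theorem Dual.ext {φ ψ : Dual R V} (h : ∀ v, φ.toFun v = ψ.toFun v) : φ = ψ := by
  cases φ; cases ψ; congr; exact LinearMap.ext h

noncomputable instance : Coded M (Dual R V) :=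
  Coded.ofInjective M Dual.toIFun (fun φ ψ h => Dual.ext fun v => DFunLike.congr_fun h v)
    (Dfn.pred_congr (P := fun f : IFun M (Elt V) (Elt R) => (∀ v w, f (v + w) = f v + f w) ∧
      (∀ (c : Elt R) v, f (c • v) = c * f v) ∧ ∀ (v : Elt V) (ε : Elt R), 0 < ε → ∃ δ : Elt R,
        0 < δ ∧ ∀ w : Elt V, NSpace.nrm (R := R) (w - v) < δ → |f w - f v| < ε)
      (by fun_prop) fun f => by
      constructor
      · rintro ⟨φ, rfl⟩
        exact ⟨map_add φ.toFun, fun c v => map_smul φ.toFun c v, φ.continuous⟩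
      · rintro ⟨h, h', hc⟩
        exact ⟨⟨⟨⟨f, h⟩, h'⟩, internal_iff.2 f.dfn, hc⟩, rfl⟩)

theorem code_toIFun (φ : Dual R V) : (code φ.toIFun : M) = code φ := rfl

instance : Small M (Dual R V) := Small.of_code_eq code_toIFun

@[fun_prop]
theorem Dfn.dual_app {f : α → Dual R V} {g : α → Elt V} (hf : Dfn M f) (hg : Dfn M g) :
    Dfn M fun a => (f a).toFun (g a) := by
  have : Dfn M (Dual.toIFun : Dual R V → _) := Dfn.of_code_eq code_toIFun
  exact Dfn.app (f := fun a => (f a).toIFun) (by fun_prop) hg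

/-- The code of a functional is its graph itself, so that membership in a set of functionals becomes
membership of the code. -/
theorem isGraph_iff_eq_code {g : M} {φ : Dual R V} : IsGraph g φ.toFun ↔ g = code φ := by
  have : ∀ p, p ∈ₘ code φ ↔ ∃ x, code (x, φ.toFun x) = p := fun p => by
    refine (mem_code_iSet (S := φ.toIFun.graph)).trans ⟨?_, ?_⟩
    · rintro ⟨⟨x, y⟩, rfl, h⟩
      exact ⟨x, by rw [← show y = φ.toFun x from h]⟩
    · rintro ⟨x, rfl⟩
      exact ⟨_, rfl, rfl⟩
  rw [isGraph_iff]
  exact ⟨fun h => ext fun p => (h p).trans (this p).symm, fun h => h ▸ this⟩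

theorem Dual.in_iff {φ : Dual R V} {O : M} : φ.In O ↔ code φ ∈ₘ O := by
  simp [Dual.In, isGraph_iff_eq_code]

theorem dfn_inBall : Dfn M (Dual.InBall : Dual R V → Prop) := by
  unfold Dual.InBall
  fun_prop

variable (R V) in
/-- The closed unit ball of the dual space. -/
def DualBall : Type u := {φ : Dual R V // φ.InBall}

namespace DualBall

/-- The inclusion of the ball. -/
def val (φ : DualBall R V) : Dual R V := Subtype.val φ

noncomputable instance : Coded M (DualBall R V) :=
  Coded.ofInjective M val Subtype.val_injective (dfn_inBall.pred_congr fun φ =>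
    ⟨fun ⟨ψ, h⟩ => h ▸ ψ.2, fun h => ⟨⟨φ, h⟩, rfl⟩⟩)

theorem code_val (φ : DualBall R V) : (code φ.val : M) = code φ := rfl

instance : Small M (DualBall R V) := Small.of_code_eq code_val

@[fun_prop]
theorem _root_.ZFModel.Dfn.ball_val {f : α → DualBall R V} (hf : Dfn M f) :
    Dfn M fun a => (f a).val :=
  (Dfn.of_code_eq code_val).comp hf

/-- Scale `v` to norm one; vectors of norm zero vanish and are treated apart. -/
theorem abs_le (φ : DualBall R V) (v : Elt V) : |φ.val.toFun v| ≤ NSpace.nrm (R := R) v := by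
  have hn0 : NSpace.nrm (R := R) (0 : Elt V) = 0 := by
    simpa using NSpace.nrm_smul (0 : Elt R) (0 : Elt V)
  have hn : 0 ≤ NSpace.nrm (R := R) v := by
    have h := NSpace.nrm_add (R := R) v (-v)
    have h' := NSpace.nrm_smul (-1 : Elt R) v
    rw [neg_one_smul, abs_neg, abs_one, one_mul] at h'
    rw [add_neg_cancel, hn0, h'] at h
    linarith
  rcases hn.eq_or_lt with h | h
  · rw [NSpace.nrm_eq_zero v h.symm, map_zero, abs_zero, hn0]
  · have := φ.2 ((NSpace.nrm (R := R) v)⁻¹ • v) (by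
      rw [NSpace.nrm_smul, abs_of_pos (inv_pos.2 h), inv_mul_cancel₀ h.ne'])
    change |φ.val.toFun _| ≤ 1 at this
    rw [map_smul, smul_eq_mul, abs_mul, abs_of_pos (inv_pos.2 h), inv_mul_le_one₀ h] at this
    exact this

end DualBall

end Spaces
/-! ### Ultrafilters of the model -/

section Ultra

variable {M : Type u} [setLang.Structure M] [IsZFModel M] {α : Type v} [Coded M α] [Small M α]

/-- Some member of `U` is given by the predicate `P`. -/
def Often (U : ISet M α → Prop) (P : α → Prop) : Prop := ∃ S : ISet M α, (∀ a, a ∈ S ↔ P a) ∧ U S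

/-- An ultrafilter of the model on the subsets of `α`. -/
structure IsUltra (U : ISet M α → Prop) : Prop where
  dfn : Dfn M U
  not_false : ¬ Often U fun _ => False
  and : ∀ P Q, Often U P → Often U Q → Often U fun a => P a ∧ Q a
  mono : ∀ P Q, Dfn M Q → (∀ a, P a → Q a) → Often U P → Often U Q
  em : ∀ P, Dfn M P → Often U P ∨ Often U fun a => ¬ P a

/-- The sets of measure one form the ultrafilter. -/
theorem BPI.exists_isUltra (h : BPI M) {𝒟 : ISet M α → Prop} (h𝒟 : Dfn M 𝒟)
    (fip : ∀ F : M, IsFin F → (∀ z, z ∈ₘ F → ∃ S, code S = z ∧ 𝒟 S) →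
      ∃ x, ∀ S : ISet M α, code S ∈ₘ F → x ∈ S) :
    ∃ U : ISet M α → Prop, IsUltra U ∧ ∀ S, 𝒟 S → U S := by
  obtain ⟨X, hX⟩ := Small.exists_range (M := M) (α := α)
  obtain ⟨P, hP⟩ := IsZFModel.power X
  have hP : IsPowerset P X := hP
  obtain ⟨D, hD⟩ := exists_comprehension h𝒟
  have hsub (S : ISet M α) : code S ∈ₘ P :=
    (hP _).2 fun z hz => (hX z).2 ((mem_code_iSet.1 hz).imp fun _ h => h.1)
  obtain ⟨μ, hμ, hμD⟩ := h X P D hP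
    (fun z hz => by obtain ⟨S, rfl, -⟩ := (hD z).1 hz; exact hsub S)
    (fun F hF hFD => by
      obtain ⟨x, hx⟩ := fip F hF fun z hz => (hD z).1 (hFD z hz)
      refine ⟨code x, (hX _).2 ⟨x, rfl⟩, fun A hA => ?_⟩
      obtain ⟨S, rfl, -⟩ := (hD A).1 (hFD A hA)
      exact code_mem_code.2 (hx S hA))
  let toP (S : ISet M α) : Elt P := ⟨code S, hsub S⟩
  have mem_toP (S : ISet M α) (z : M) : z ∈ₘ (toP S).1 ↔ ∃ a, code a = z ∧ a ∈ S := mem_code_iSet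
  let m (S : ISet M α) : ℕ := μ (toP S)
  have mcongr {S T : ISet M α} (h : ∀ a, a ∈ S ↔ a ∈ T) : m S = m T := by
    rw [SetLike.ext h]
  have madd {S T V : ISet M α} (h1 : ∀ a, ¬ (a ∈ S ∧ a ∈ T)) (h2 : ∀ a, a ∈ V ↔ a ∈ S ∨ a ∈ T) :
      m V = m S + m T := by
    refine hμ.additive _ _ _ (fun x => ?_) fun x => ?_
    · rintro ⟨hx, hx'⟩
      obtain ⟨a, rfl, ha⟩ := mem_code_iSet.1 hx
      exact h1 a ⟨ha, code_mem_code.1 hx'⟩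
    · rw [mem_toP, mem_toP, mem_toP]
      simp only [h2]
      grind
  have m01 (S : ISet M α) : m S = 0 ∨ m S = 1 := hμ.two_valued _
  have mwhole {S : ISet M α} (h : ∀ a, a ∈ S) : m S = 1 :=
    hμ.whole _ (ext fun z => by rw [mem_toP]; simp [hX, h])
  have mempty {S : ISet M α} (h : ∀ a, a ∉ S) : m S = 0 :=
    hμ.empty _ fun z => by rw [mem_toP]; simp [h]
  have often {P : α → Prop} (hP : Dfn M P) :
      Often (fun S => m S = 1) P ↔ m ⟨{a | P a}, hP⟩ = 1 := by
    refine ⟨?_, fun h => ⟨_, fun a => Iff.rfl, h⟩⟩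
    rintro ⟨S, hS, h⟩
    rw [← h]
    exact mcongr fun a => (hS a).symm
  have odfn {P : α → Prop} (h : Often (fun S => m S = 1) P) : Dfn M P := by
    obtain ⟨S, hS, -⟩ := h
    exact S.dfn_mem.pred_congr fun a => (hS a).symm
  have hmono {P Q : α → Prop} (hQ : Dfn M Q) (hPQ : ∀ a, P a → Q a)
      (h : Often (fun S => m S = 1) P) : Often (fun S => m S = 1) Q := by
    have hP := odfn h
    rw [often hP] at h
    rw [often hQ]
    have := madd (S := ⟨{a | P a}, hP⟩) (T := ⟨{a | ¬ P a ∧ Q a}, hP.not.and hQ⟩)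
      (V := ⟨{a | Q a}, hQ⟩) (fun a h => h.2.1 h.1) (fun a => by
        change Q a ↔ P a ∨ ¬ P a ∧ Q a
        have := hPQ a
        tauto)
    have := m01 ⟨{a | Q a}, hQ⟩
    omega
  refine ⟨fun S => m S = 1, ⟨?_, ?_, ?_, fun P Q => hmono, ?_⟩, fun S hS => ?_⟩
  · refine (internalSet_iff.1 hμ.internal).comp (f := toP) (Dfn.to_elt (f := toP) Dfn.code_fun)
  · intro h
    rw [often (odfn h), mempty (S := ⟨{_a | False}, Dfn.const False⟩) (fun _ h => h)] at h
    omega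
  · intro P Q hP hQ
    have hP' := odfn hP
    have hQ' := odfn hQ
    rw [often hP'] at hP
    rw [often hQ'] at hQ
    rw [often (hP'.and hQ')]
    have h1 := madd (S := ⟨{a | P a ∧ Q a}, hP'.and hQ'⟩)
      (T := ⟨{a | P a ∧ ¬ Q a}, hP'.and hQ'.not⟩)
      (V := ⟨{a | P a}, hP'⟩) (fun a h => h.2.2 h.1.2) (fun a => by
        change P a ↔ P a ∧ Q a ∨ P a ∧ ¬ Q a
        tauto)
    -- `Q` already has measure one, so the disjoint set `P ∧ ¬ Q` is null and `P ∧ Q` carries the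
    -- whole measure of `P`.
    have h2 := madd (S := ⟨{a | Q a}, hQ'⟩) (T := ⟨{a | P a ∧ ¬ Q a}, hP'.and hQ'.not⟩)
      (V := ⟨{a | Q a ∨ P a ∧ ¬ Q a}, hQ'.or (hP'.and hQ'.not)⟩) (fun a h => h.2.2 h.1)
      (fun a => Iff.rfl)
    have := m01 ⟨{a | Q a ∨ P a ∧ ¬ Q a}, hQ'.or (hP'.and hQ'.not)⟩
    omega
  · intro P hP
    rw [often hP, often hP.not]
    have h1 := madd (S := ⟨{a | P a}, hP⟩) (T := ⟨{a | ¬ P a}, hP.not⟩)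
      (V := ⟨{_a | True}, Dfn.const True⟩) (fun a h => h.2 h.1)
      (fun a => by change True ↔ P a ∨ ¬ P a; tauto)
    rw [mwhole (S := ⟨{_a | True}, _⟩) fun a => trivial] at h1
    have := m01 ⟨{a | P a}, hP⟩
    omega
  · have := hμD ⟨code S, hsub S⟩ ((hD _).2 ⟨S, rfl, hS⟩)
    exact (m01 S).resolve_left (Nat.pos_iff_ne_zero.1 this)

theorem IsUltra.dfn_often {U : ISet M α → Prop} (hU : IsUltra U) {β : Type w} [Coded M β]
    {P : β → α → Prop} (hP : Dfn M fun p : β × α => P p.1 p.2) :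
    Dfn M fun b => Often U (P b) := by
  obtain ⟨Q, hQ⟩ : ∃ Q : β × α → Prop, ∀ b a, P b a ↔ Q (b, a) :=
    ⟨fun p => P p.1 p.2, fun _ _ => Iff.rfl⟩
  replace hP : Dfn M Q := hP.pred_congr fun p => (hQ _ _).symm
  have := hU.dfn
  simp only [Often, hQ]
  fun_prop

theorem IsUltra.exists_of_often {U : ISet M α → Prop} (hU : IsUltra U) {P : α → Prop}
    (h : Often U P) : ∃ a, P a := by
  by_contra! hP
  exact hU.not_false (hU.mono _ _ (.const False) hP h)

/-- The limit is the supremum of all `t` that lie below `f` on a set of the ultrafilter. This set of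
`t` is definable, so Dedekind completeness in the model applies. -/
theorem IsUltra.exists_limit {U : ISet M α → Prop} (hU : IsUltra U) {R : M} [RealLine R]
    {f : α → Elt R} (hf : Dfn M f) {c : Elt R} (hc : ∀ a, |f a| ≤ c) :
    ∃ t, ∀ e, 0 < e → Often U fun a => |f a - t| < e := by
  have htop : ∀ P : α → Prop, Dfn M P → (∀ a, P a) → Often U P := fun P hP h => by
    refine (hU.em P hP).elim (fun h => h) fun h' => (hU.not_false (hU.mono _ _ (.const False)
      (fun a ha => ha (h a)) h')).elim
  have hd : Dfn M fun t : Elt R => Often U fun a => t ≤ f a := hU.dfn_often (by fun_prop)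
  obtain ⟨s, hs⟩ := RealLine.complete {t : Elt R | Often U fun a => t ≤ f a} (internalSet_iff.2 hd)
    ⟨-c, htop _ (by fun_prop) fun a => (abs_le.1 (hc a)).1⟩
    ⟨c, fun t ht => by
      obtain ⟨a, ha⟩ := hU.exists_of_often ht
      exact ha.trans (abs_le.1 (hc a)).2⟩
  refine ⟨s, fun e he => ?_⟩
  obtain ⟨t, ht, hst⟩ : ∃ t, (Often U fun a => t ≤ f a) ∧ s - e < t := by
    by_contra! h
    have := hs.2 (show s - e ∈ upperBounds _ from h)
    linarith
  have h2 : ¬ Often U fun a => s + e / 2 ≤ f a := fun h => by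
    have := hs.1 h
    linarith
  have h3 := (hU.em (fun a => s + e / 2 ≤ f a) (by fun_prop)).resolve_left h2
  refine hU.mono _ _ (by fun_prop) (fun a ha => ?_) (hU.and _ _ ht h3)
  rw [abs_lt]
  have := not_le.1 ha.2
  constructor <;> linarith [ha.1]

end Ultra

/-! ### The Boolean Prime Ideal theorem implies the Banach-Alaoglu theorem -/

section Forward

variable {M : Type u} [setLang.Structure M] [IsZFModel M]

theorem IsUltra.exists_limit_functional {R V : M} [RealLine R] [NSpace R V]
    {U : ISet M (DualBall R V) → Prop} (hU : IsUltra U) :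
    ∃ φ : DualBall R V, ∀ (v : Elt V) (e : Elt R), 0 < e →
      Often U fun ψ => |ψ.val.toFun v - φ.val.toFun v| < e := by
  choose L hL using fun v : Elt V => hU.exists_limit
    (f := fun ψ : DualBall R V => ψ.val.toFun v) (by fun_prop) fun ψ => ψ.abs_le v
  -- Uniqueness makes the chosen `L` definable, and it reduces linearity to limits of sums and
  -- multiples.
  have huniq (v : Elt V) (t : Elt R)
      (ht : ∀ e, 0 < e → Often U fun ψ => |ψ.val.toFun v - t| < e) : t = L v := by
    by_contra hne
    have hpos : 0 < |t - L v| / 2 := by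
      have := abs_pos.2 (sub_ne_zero.2 hne)
      positivity
    obtain ⟨ψ, h1, h2⟩ := hU.exists_of_often (hU.and _ _ (ht _ hpos) (hL v _ hpos))
    have := abs_sub_le t (ψ.val.toFun v) (L v)
    rw [abs_sub_comm t (ψ.val.toFun v)] at this
    linarith
  have hd : Dfn M L := by
    have h1 : Dfn M fun p : (Elt V × Elt R) × Elt R =>
        Often U fun ψ => |ψ.val.toFun p.1.1 - p.1.2| < p.2 := hU.dfn_often (by fun_prop)
    refine Dfn.of_graph (R := fun v t => ∀ e, 0 < e → Often U fun ψ => |ψ.val.toFun v - t| < e)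
      (.all (.imp (by fun_prop) h1)) fun v t => ⟨huniq v t, ?_⟩
    rintro rfl
    exact hL v
  have hadd (v w : Elt V) : L (v + w) = L v + L w := by
    refine (huniq _ _ fun e he => ?_).symm
    refine hU.mono _ _ (by fun_prop) (fun ψ hψ => ?_)
      (hU.and _ _ (hL v (e / 2) (half_pos he)) (hL w (e / 2) (half_pos he)))
    rw [map_add, add_sub_add_comm]
    exact (abs_add_le _ _).trans_lt (by linarith [hψ.1, hψ.2])
  have hsmul (c : Elt R) (v : Elt V) : L (c • v) = c * L v := by
    refine (huniq _ _ fun e he => ?_).symm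
    have hc : 0 < |c| + 1 := by positivity
    refine hU.mono _ _ (by fun_prop) (fun ψ hψ => ?_) (hL v (e / (|c| + 1)) (div_pos he hc))
    rw [map_smul, smul_eq_mul, ← mul_sub, abs_mul]
    rw [lt_div_iff₀ hc] at hψ
    nlinarith [abs_nonneg (ψ.val.toFun v - L v)]
  have hbd (v : Elt V) : |L v| ≤ NSpace.nrm (R := R) v := by
    by_contra! h
    obtain ⟨ψ, hψ⟩ := hU.exists_of_often (hL v _ (sub_pos.2 h))
    have h1 := ψ.abs_le v
    have h2 := abs_sub_abs_le_abs_sub (L v) (ψ.val.toFun v)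
    rw [abs_sub_comm] at h2
    linarith
  let φ : Dual R V :=
    { toFun := { toFun := L, map_add' := hadd, map_smul' := hsmul }
      internal := internal_iff.2 hd
      continuous := fun v e he => ⟨e, he, fun w hw => by
        rw [← map_sub]
        exact (hbd _).trans_lt hw⟩ }
  exact ⟨⟨φ, fun v hv => (hbd v).trans hv⟩, hL⟩

theorem BPI.banachAlaoglu (h : BPI M) : BanachAlaoglu M := by
  intro R V _ _ C hC hcov
  by_contra! hcon
  obtain ⟨U, hU, hUD⟩ := h.exists_isUltra (α := DualBall R V)
    (𝒟 := fun S => ∃ O, O ∈ₘ C ∧ ∀ φ, φ ∈ S ↔ ¬ code φ ∈ₘ O) (by fun_prop) (by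
    intro F hF hFD
    -- `F` is finite only in the sense of the model, so the members of the cover behind its elements
    -- are gathered by induction in the model.
    have key : ∃ C', IsFin C' ∧ (∀ O, O ∈ₘ C' → O ∈ₘ C) ∧ ∀ S : ISet M (DualBall R V),
        code S ∈ₘ F → ∃ O, O ∈ₘ C' ∧ ∀ φ, φ ∈ S ↔ ¬ code φ ∈ₘ O := by
      refine hF.induction (P := fun F => ∃ C', IsFin C' ∧ (∀ O, O ∈ₘ C' → O ∈ₘ C) ∧
        ∀ S : ISet M (DualBall R V), code S ∈ₘ F → ∃ O, O ∈ₘ C' ∧ ∀ φ, φ ∈ S ↔ ¬ code φ ∈ₘ O)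
        (by fun_prop) (fun e he => ⟨e, isFin_empty he, fun O hO => (he O hO).elim,
          fun S hS => (he _ hS).elim⟩) ?_
      rintro y z w ⟨C', hfin, hsub, hC'⟩ hz - hw
      obtain ⟨S, rfl, O, hO, hSO⟩ := hFD z hz
      obtain ⟨C'', hC''⟩ := exists_insert C' O
      refine ⟨C'', hfin.insert hC'', fun O' h => ?_, fun T hT => ?_⟩
      · rcases (hC'' _).1 h with h | rfl
        exacts [hsub _ h, hO]
      · rcases (hw _).1 hT with h | h
        · obtain ⟨O', h1, h2⟩ := hC' T h
          exact ⟨O', (hC'' _).2 (Or.inl h1), h2⟩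
        · cases Coded.code_injective h
          exact ⟨O, (hC'' _).2 (Or.inr rfl), hSO⟩
    obtain ⟨C', hfin, hsub, hC'⟩ := key
    obtain ⟨φ, hφ, hφC⟩ := hcon C' hfin hsub
    refine ⟨⟨φ, hφ⟩, fun S hS => ?_⟩
    obtain ⟨O, hO, hSO⟩ := hC' S hS
    exact (hSO _).2 fun h => hφC O hO (Dual.in_iff.2 h))
  obtain ⟨φ, hφ⟩ := hU.exists_limit_functional
  obtain ⟨O, hO, hφO⟩ := hcov φ.val φ.2
  obtain ⟨s, e, hs, hsV, he, hnb⟩ := (hC O hO).2 φ.val hφO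
  have hall : Often U fun ψ => ∀ v : Elt V, v.1 ∈ₘ s → |ψ.val.toFun v - φ.val.toFun v| < e := by
    -- Closure under finite intersections is likewise an induction on the finite set `s` of the
    -- model.
    refine hs.induction (P := fun s => Often U fun ψ => ∀ v : Elt V, v.1 ∈ₘ s →
      |ψ.val.toFun v - φ.val.toFun v| < e) (hU.dfn_often (by fun_prop)) ?_ ?_
    · intro y hy
      refine (hU.em (fun ψ => ∀ v : Elt V, v.1 ∈ₘ y → |ψ.val.toFun v - φ.val.toFun v| < e)
        (by fun_prop)).elim (fun h => h) fun h => (hU.not_false (hU.mono _ _ (.const False)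
        (fun ψ hψ => hψ fun v hv => (hy _ hv).elim) h)).elim
    · rintro y z w hy hz - hw
      refine hU.mono _ _ (by fun_prop) (fun ψ hψ v hv => ?_) (hU.and _ _ hy (hφ ⟨z, hsV z hz⟩ e he))
      rcases (hw _).1 hv with h | h
      · exact hψ.1 v h
      · rw [show v = ⟨z, hsV z hz⟩ from Subtype.ext h]
        exact hψ.2
  have hd : Dfn M fun ψ : DualBall R V => ¬ code ψ ∈ₘ O := by fun_prop
  have hO' : Often U fun ψ : DualBall R V => ¬ code ψ ∈ₘ O :=
    ⟨⟨{ψ | ¬ code ψ ∈ₘ O}, hd⟩, fun _ => Iff.rfl, hUD _ ⟨O, hO, fun _ => Iff.rfl⟩⟩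
  obtain ⟨ψ, h1, h2⟩ := hU.exists_of_often (hU.and _ _ hall hO')
  exact h2 (Dual.in_iff.1 (hnb ψ.val h1))

end Forward
/-! ### The normed space of the bounded functions -/

section BddFun

variable {M : Type u} [setLang.Structure M] [IsZFModel M]

/-- The bounded functions of the model from `α` to the real line. -/
def BddFun (R : M) [RealLine R] (α : Type v) [Coded M α] : Submodule (Elt R) (α → Elt R) where
  carrier := {f | Dfn M f ∧ ∃ c, ∀ a, |f a| ≤ c}
  zero_mem' := ⟨.const 0, 0, fun a => by simp⟩
  add_mem' := by
    rintro f g ⟨hf, c, hc⟩ ⟨hg, d, hd⟩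
    exact ⟨hf.real_add hg, c + d, fun a => (abs_add_le _ _).trans (add_le_add (hc a) (hd a))⟩
  smul_mem' := by
    rintro r f ⟨hf, c, hc⟩
    refine ⟨(Dfn.const r).real_mul hf, |r| * c, fun a => ?_⟩
    rw [Pi.smul_apply, smul_eq_mul, abs_mul]
    exact mul_le_mul_of_nonneg_left (hc a) (abs_nonneg r)

namespace BddFun

variable {R : M} [RealLine R] {α : Type v} [Coded M α] [Small M α]

/-- A bounded function as a function of the model. -/
def toIFun (f : BddFun R α) : IFun M α (Elt R) := ⟨f.1, f.2.1⟩

noncomputable instance : Coded M (BddFun R α) :=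
  Coded.ofInjective M toIFun (fun f g h => Subtype.ext (congrArg IFun.toFun h))
    (Dfn.pred_congr (P := fun f : IFun M α (Elt R) => ∃ c, ∀ a, |f a| ≤ c) (by fun_prop) fun f =>
      ⟨fun ⟨g, h⟩ => h ▸ g.2.2, fun h => ⟨⟨f, f.dfn, h⟩, rfl⟩⟩)

theorem code_toIFun (f : BddFun R α) : (code (toIFun f) : M) = code f := rfl

instance : Small M (BddFun R α) := Small.of_code_eq code_toIFun

theorem dfn_toIFun : Dfn M (toIFun : BddFun R α → _) := Dfn.of_code_eq code_toIFun

@[fun_prop]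
theorem _root_.ZFModel.Dfn.bddFun_app {β : Type w} [Coded M β] {f : β → BddFun R α} {g : β → α}
    (hf : Dfn M f) (hg : Dfn M g) : Dfn M fun b => (f b).1 (g b) :=
  Dfn.app (dfn_toIFun.comp hf) hg

theorem _root_.ZFModel.Dfn.to_bddFun {β : Type w} [Coded M β] {f : β → BddFun R α}
    (hf : Dfn M fun p : β × α => (f p.1).1 p.2) : Dfn M f :=
  (dfn_comp_iff_of_code_eq code_toIFun).1 (Dfn.to_iFun hf)

theorem exists_norm (f : BddFun R α) : ∃ s : Elt R, 0 ≤ s ∧ (∀ a, |f.1 a| ≤ s) ∧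
    ∀ c, 0 ≤ c → (∀ a, |f.1 a| ≤ c) → s ≤ c := by
  -- The value 0 is adjoined so that the supremum exists for empty `α` as well.
  obtain ⟨s, hs⟩ := RealLine.complete {r : Elt R | r = 0 ∨ ∃ a, r = |f.1 a|}
    (internalSet_iff.2 (show Dfn M fun r : Elt R => r = 0 ∨ ∃ a, r = |f.1 a| by fun_prop))
    ⟨0, Or.inl rfl⟩ (by
      obtain ⟨c, hc⟩ := f.2.2
      refine ⟨max c 0, ?_⟩
      rintro r (rfl | ⟨a, rfl⟩)
      exacts [le_max_right _ _, (hc a).trans (le_max_left _ _)])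
  refine ⟨s, hs.1 (Or.inl rfl), fun a => hs.1 (Or.inr ⟨a, rfl⟩), fun c h0 hc => hs.2 ?_⟩
  rintro r (rfl | ⟨a, rfl⟩)
  exacts [h0, hc a]

/-- The supremum norm. -/
noncomputable def norm (f : BddFun R α) : Elt R := (exists_norm f).choose

theorem norm_nonneg (f : BddFun R α) : 0 ≤ norm f := (exists_norm f).choose_spec.1

theorem norm_le_iff {f : BddFun R α} {c : Elt R} (hc : 0 ≤ c) :
    norm f ≤ c ↔ ∀ a, |f.1 a| ≤ c :=
  ⟨fun h a => ((exists_norm f).choose_spec.2.1 a).trans h, (exists_norm f).choose_spec.2.2 c hc⟩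

theorem abs_le_norm (f : BddFun R α) (a : α) : |f.1 a| ≤ norm f :=
  (norm_le_iff (norm_nonneg f)).1 le_rfl a

theorem dfn_norm : Dfn M (norm : BddFun R α → _) := by
  refine Dfn.of_graph (R := fun f s => 0 ≤ s ∧ (∀ a, |f.1 a| ≤ s) ∧
    ∀ c, 0 ≤ c → (∀ a, |f.1 a| ≤ c) → s ≤ c) (by fun_prop) fun f s => ⟨?_, ?_⟩
  · rintro ⟨h0, h1, h2⟩
    exact le_antisymm (h2 _ (norm_nonneg f) (abs_le_norm f)) ((norm_le_iff h0).2 h1)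
  · rintro rfl
    exact ⟨norm_nonneg f, abs_le_norm f, fun c hc => (norm_le_iff hc).2⟩

theorem norm_smul (c : Elt R) (f : BddFun R α) : norm (c • f) = |c| * norm f := by
  have hsm (a : α) : |(c • f).1 a| = |c| * |f.1 a| := abs_mul c (f.1 a)
  refine le_antisymm ((norm_le_iff (mul_nonneg (abs_nonneg c) (norm_nonneg f))).2 fun a => ?_) ?_
  · rw [hsm]
    exact mul_le_mul_of_nonneg_left (abs_le_norm f a) (abs_nonneg c)
  · rcases eq_or_ne c 0 with rfl | hc
    · simpa using norm_nonneg _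
    · have hc := abs_pos.2 hc
      rw [← le_div_iff₀' hc, norm_le_iff (div_nonneg (norm_nonneg _) hc.le)]
      intro a
      rw [le_div_iff₀' hc, ← hsm]
      exact abs_le_norm _ a

variable (R α) in
theorem exists_nSpace : ∃ (V : M) (_ : NSpace R V) (e : Elt V ≃ₗ[Elt R] BddFun R α),
    Dfn M e ∧ Dfn M e.symm ∧ ∀ v, NSpace.nrm (R := R) v = norm (e v) := by
  obtain ⟨V, e, he, he'⟩ := exists_elt_equiv (M := M) (BddFun R α)
  let gV : AddCommGroup (Elt V) := e.addCommGroup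
  let mV : Module (Elt R) (Elt V) := e.module (Elt R)
  let e' : Elt V ≃ₗ[Elt R] BddFun R α := e.linearEquiv (Elt R)
  have hadd : Dfn M fun p : BddFun R α × BddFun R α => p.1 + p.2 :=
    Dfn.to_bddFun (show Dfn M fun p : (BddFun R α × BddFun R α) × α => p.1.1.1 p.2 + p.1.2.1 p.2
      by fun_prop)
  have hsmul : Dfn M fun p : Elt R × BddFun R α => p.1 • p.2 :=
    Dfn.to_bddFun (show Dfn M fun p : (Elt R × BddFun R α) × α => p.1.1 * p.1.2.1 p.2
      by fun_prop)
  refine ⟨V, { gV, mV with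
    nrm := fun v => norm (e v)
    internal_add := ?_
    internal_smul := ?_
    internal_nrm := internal_iff.2 (dfn_norm.comp he)
    nrm_eq_zero := fun v hv => ?_
    nrm_add := fun v w => ?_
    nrm_smul := fun c v => ?_ }, e', he, he', fun v => rfl⟩
  · exact internal₂_iff.2 (he'.comp (hadd.comp (f := fun p : Elt V × Elt V => (e p.1, e p.2))
      (by fun_prop)))
  · exact internal₂_iff.2 (he'.comp (hsmul.comp (f := fun p : Elt R × Elt V => (p.1, e p.2))
      (by fun_prop)))
  · have : e' v = 0 := Subtype.ext (funext fun a => by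
      have := abs_le_norm (e v) a
      rw [hv] at this
      exact abs_nonpos_iff.1 this)
    exact (e'.map_eq_zero_iff).1 this
  · change norm (e' (v + w)) ≤ norm (e' v) + norm (e' w)
    rw [map_add, norm_le_iff (add_nonneg (norm_nonneg _) (norm_nonneg _))]
    exact fun a => (abs_add_le _ _).trans (add_le_add (abs_le_norm _ a) (abs_le_norm _ a))
  · change norm (e' (c • v)) = |c| * norm (e' v)
    rw [map_smul, norm_smul]

open Classical in
/-- The indicator function of a set. -/
noncomputable def indicator (R : M) [RealLine R] (S : ISet M α) : BddFun R α :=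
  ⟨fun a => if a ∈ S then 1 else 0,
    Dfn.of_graph (R := fun a z => a ∈ S ∧ z = 1 ∨ ¬ a ∈ S ∧ z = 0) (by fun_prop)
      fun a z => by by_cases h : a ∈ S <;> simp [h],
    1, fun a => by by_cases h : a ∈ S <;> simp [h]⟩

theorem indicator_of_mem {S : ISet M α} {a : α} (h : a ∈ S) : (indicator R S).1 a = 1 := if_pos h

theorem indicator_of_notMem {S : ISet M α} {a : α} (h : a ∉ S) : (indicator R S).1 a = 0 :=
  if_neg h

@[fun_prop]
theorem dfn_indicator : Dfn M (indicator R : ISet M α → _) := by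
  refine Dfn.to_bddFun (Dfn.of_graph (R := fun p z => p.2 ∈ p.1 ∧ z = 1 ∨ ¬ p.2 ∈ p.1 ∧ z = 0)
    (by fun_prop) fun p z => ?_)
  by_cases h : p.2 ∈ p.1
  · simp [h, indicator_of_mem]
  · simp [h, indicator_of_notMem]

end BddFun

end BddFun

/-! ### The Banach-Alaoglu theorem implies the Boolean Prime Ideal theorem -/

section Backward

variable {M : Type u} [setLang.Structure M] [IsZFModel M]

theorem BanachAlaoglu.bpi (h : BanachAlaoglu M) : BPI M := by
  intro X P D hP hDP hfip
  obtain ⟨R, ⟨_⟩⟩ := exists_realLine M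
  obtain ⟨V, _, e, he, he', hnrm⟩ := BddFun.exists_nSpace R (Elt X)
  let χ (S : ISet M (Elt X)) : Elt V := e.symm (BddFun.indicator R S)
  have hχ : Dfn M χ := he'.comp BddFun.dfn_indicator
  have heval (x : Elt X) : ∃ φ : Dual R V, φ.InBall ∧ ∀ v, φ.toFun v = (e v).1 x := by
    have hle (v : Elt V) : |(e v).1 x| ≤ NSpace.nrm (R := R) v :=
      hnrm v ▸ BddFun.abs_le_norm _ x
    refine ⟨{ toFun := (LinearMap.proj x).comp ((BddFun R (Elt X)).subtype.comp e.toLinearMap)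
              internal := internal_iff.2 (show Dfn M fun v => (e v).1 x by fun_prop)
              continuous := fun v ε hε => ⟨ε, hε, fun w hw => ?_⟩ }, fun v hv => ?_, fun v => rfl⟩
    · rw [← map_sub]
      exact (hle _).trans_lt hw
    · exact (hle v).trans hv
  -- Each bad set collects the functionals that violate one of the required conditions. The clause
  -- `∀ x, x ∈ S` stands for `S = X`; the parameter `D'` records which members of `D` a finite
  -- subcover uses.
  let Bad (D' : M) (O : ISet M (Dual R V)) : Prop :=
    (∃ S, ∀ φ : Dual R V, φ ∈ O ↔ φ.toFun (χ S) ≠ 0 ∧ φ.toFun (χ S) ≠ 1) ∨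
      ∃ S, (code S ∈ₘ D' ∨ ∀ x, x ∈ S) ∧ ∀ φ : Dual R V, φ ∈ O ↔ φ.toFun (χ S) ≠ 1
  have hBad : Dfn M fun p : M × ISet M (Dual R V) => Bad p.1 p.2 := by
    unfold Bad
    fun_prop
  obtain ⟨C, hC⟩ := exists_comprehension (P := Bad D)
    (hBad.comp (f := fun O : ISet M (Dual R V) => (D, O)) (by fun_prop))
  have hopen (O : M) (hO : O ∈ₘ C) : IsWeakStarOpen R V O := by
    obtain ⟨O, rfl, hBO⟩ := (hC _).1 hO
    refine ⟨fun g hg => ?_, fun φ hφ => ?_⟩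
    · obtain ⟨φ, rfl, -⟩ := mem_code_iSet.1 hg
      exact ⟨φ, isGraph_iff_eq_code.2 rfl⟩
    · rw [Dual.in_iff, code_mem_code] at hφ
      simp only [Dual.in_iff, code_mem_code]
      have hsing (v : Elt V) : ∃ s : M, IsFin s ∧ Sub s V ∧ v.1 ∈ₘ s := by
        obtain ⟨z, ⟨y, -, hy⟩, -⟩ := IsZFModel.infinity (M := M)
        obtain ⟨s, hs⟩ := exists_insert y v.1
        refine ⟨s, (isFin_empty hy).insert hs, fun t ht => ?_, (hs _).2 (Or.inr rfl)⟩
        rcases (hs t).1 ht with h | rfl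
        exacts [(hy t h).elim, v.2]
      rcases hBO with ⟨S, hS⟩ | ⟨S, -, hS⟩ <;> obtain ⟨s, hs, hsV, hvs⟩ := hsing (χ S) <;>
        simp only [hS] at hφ ⊢
      -- The radius is the distance to the excluded values; the neighbourhood tests only the vector
      -- `χ S`.
      · refine ⟨s, min |φ.toFun (χ S)| |φ.toFun (χ S) - 1|, hs, hsV,
          lt_min (abs_pos.2 hφ.1) (abs_pos.2 (sub_ne_zero.2 hφ.2)), fun ψ hψ => ?_⟩
        have := lt_min_iff.1 (hψ _ hvs)
        constructor <;> intro h0 <;> rw [h0] at this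
        · simp at this
        · rw [abs_sub_comm 1] at this
          exact this.2.false
      · refine ⟨s, |φ.toFun (χ S) - 1|, hs, hsV, abs_pos.2 (sub_ne_zero.2 hφ), fun ψ hψ h0 => ?_⟩
        have := hψ _ hvs
        rw [h0, abs_sub_comm 1] at this
        exact this.false
  by_cases hcov : ∀ φ : Dual R V, φ.InBall → ∃ O, O ∈ₘ C ∧ φ.In O
  · obtain ⟨C', hfin, hsub, hC'⟩ := h R V C hopen hcov
    -- By induction along the finite subcover; only bad sets attached to a member of `D` enlarge
    -- `D'`.
    have key : ∃ D', IsFin D' ∧ Sub D' D ∧ ∀ O : ISet M (Dual R V), code O ∈ₘ C' → Bad D' O := by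
      obtain ⟨B, hB⟩ : ∃ B : M × ISet M (Dual R V) → Prop, ∀ D' O, Bad D' O ↔ B (D', O) :=
        ⟨fun p => Bad p.1 p.2, fun _ _ => Iff.rfl⟩
      have hBd : Dfn M B := hBad.pred_congr fun p => (hB _ _).symm
      refine hfin.induction (P := fun C' => ∃ D', IsFin D' ∧ Sub D' D ∧
        ∀ O : ISet M (Dual R V), code O ∈ₘ C' → Bad D' O) ?_ ?_ ?_
      · simp only [hB]
        fun_prop
      · exact fun y hy => ⟨y, isFin_empty hy, fun z hz => (hy z hz).elim,
          fun O hO => (hy _ hO).elim⟩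
      · rintro y z w ⟨D', hf, hs, hD'⟩ hz - hw
        obtain ⟨O, rfl, hO⟩ := (hC z).1 (hsub z hz)
        have step : ∃ D'', IsFin D'' ∧ Sub D'' D ∧ Sub D' D'' ∧ Bad D'' O := by
          rcases hO with h | ⟨S, h | h, hS⟩
          · exact ⟨D', hf, hs, fun _ h => h, Or.inl h⟩
          · obtain ⟨D'', hD''⟩ := exists_insert D' (code S)
            refine ⟨D'', hf.insert hD'', fun t ht => ?_, fun t ht => (hD'' t).2 (Or.inl ht),
              Or.inr ⟨S, Or.inl ((hD'' _).2 (Or.inr rfl)), hS⟩⟩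
            rcases (hD'' t).1 ht with h' | rfl
            exacts [hs t h', h]
          · exact ⟨D', hf, hs, fun _ h => h, Or.inr ⟨S, Or.inr h, hS⟩⟩
        obtain ⟨D'', hf', hs', hss, hO'⟩ := step
        refine ⟨D'', hf', hs', fun O' h => ?_⟩
        rcases (hw _).1 h with h | h
        · exact (hD' O' h).imp_right fun ⟨S, h, hS⟩ => ⟨S, h.imp_left (hss _), hS⟩
        · cases Coded.code_injective h
          exact hO'
    obtain ⟨D', hf, hs, hD'⟩ := key
    obtain ⟨x, hx, hxD⟩ := hfip D' hf hs
    -- Evaluation at a common point of `D'` is in the ball but in none of the sets of the subcover.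
    obtain ⟨φ, hφ, hφx⟩ := heval ⟨x, hx⟩
    obtain ⟨O, hO, hφO⟩ := hC' φ hφ
    obtain ⟨O, rfl, -⟩ := (hC O).1 (hsub O hO)
    rw [Dual.in_iff, code_mem_code] at hφO
    have hev (S : ISet M (Elt X)) : φ.toFun (χ S) = (BddFun.indicator R S).1 ⟨x, hx⟩ := by
      rw [hφx, e.apply_symm_apply]
    rcases hD' O hO with ⟨S, hS⟩ | ⟨S, hS', hS⟩
    · rw [hS, hev] at hφO
      by_cases hxS : (⟨x, hx⟩ : Elt X) ∈ S
      · exact (hφO.2 (BddFun.indicator_of_mem hxS)).elim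
      · exact (hφO.1 (BddFun.indicator_of_notMem hxS)).elim
    · rw [hS, hev] at hφO
      refine (hφO (BddFun.indicator_of_mem ?_)).elim
      rcases hS' with h | h
      · exact code_mem_code.1 (hxD _ h)
      · exact h _
  · push Not at hcov
    obtain ⟨φ, -, hφC⟩ := hcov
    -- The uncovered functional avoids every bad set, so all the conditions hold for it.
    have hnot (O : ISet M (Dual R V)) (hO : Bad D O) : φ ∉ O := fun h =>
      hφC _ ((hC _).2 ⟨O, rfl, hO⟩) (Dual.in_iff.2 (code_mem_code.2 h))
    have h01 (S : ISet M (Elt X)) : φ.toFun (χ S) = 0 ∨ φ.toFun (χ S) = 1 := by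
      by_contra! hc
      have hd : Dfn M fun φ : Dual R V => φ.toFun (χ S) ≠ 0 ∧ φ.toFun (χ S) ≠ 1 := by fun_prop
      exact hnot ⟨{φ | _}, hd⟩ (Or.inl ⟨S, fun _ => Iff.rfl⟩) hc
    have h1 (S : ISet M (Elt X)) (hS : code S ∈ₘ D ∨ ∀ x, x ∈ S) : φ.toFun (χ S) = 1 := by
      by_contra hc
      have hd : Dfn M fun φ : Dual R V => φ.toFun (χ S) ≠ 1 := by fun_prop
      exact hnot ⟨{φ | _}, hd⟩ (Or.inr ⟨S, hS, fun _ => Iff.rfl⟩) hc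
    let T (A : Elt P) : ISet M (Elt X) :=
      ⟨{x | x.1 ∈ₘ A.1}, show Dfn M fun x : Elt X => x.1 ∈ₘ A.1 by fun_prop⟩
    have hT : Dfn M T := Dfn.to_iSet
      (show Dfn M fun p : Elt P × Elt X => p.2.1 ∈ₘ p.1.1 by fun_prop)
    have code_T (A : Elt P) : code (T A) = A.1 := ext fun z => by
      refine mem_code_iSet.trans ⟨?_, fun hz => ⟨⟨z, (hP _).1 A.2 z hz⟩, rfl, hz⟩⟩
      rintro ⟨x, rfl, hx⟩
      exact hx
    have h10 : (1 : Elt R) ≠ 0 := one_ne_zero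
    classical
    let μ (A : Elt P) : ℕ := if φ.toFun (χ (T A)) = 1 then 1 else 0
    have μ1 (A : Elt P) : μ A = 1 ↔ φ.toFun (χ (T A)) = 1 := by
      by_cases h : φ.toFun (χ (T A)) = 1 <;> simp [μ, h]
    refine ⟨μ, ⟨?_, fun A => ?_, fun A hA => ?_, fun A hA => ?_, fun A B E hAB hE => ?_⟩,
      fun A hA => ?_⟩
    · exact internalSet_iff.2 (Dfn.pred_congr (P := fun A => φ.toFun (χ (T A)) = 1)
        (by fun_prop) μ1)
    · by_cases h : φ.toFun (χ (T A)) = 1 <;> simp [μ, h]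
    · have : χ (T A) = 0 := by
        refine e.injective ?_
        rw [e.apply_symm_apply, map_zero]
        exact Subtype.ext (funext fun x => BddFun.indicator_of_notMem (hA x.1))
      simp [μ, this]
    · exact (μ1 A).2 (h1 _ (Or.inr fun x => by
        change x.1 ∈ₘ A.1
        rw [hA]
        exact x.2))
    · have hsum : χ (T E) = χ (T A) + χ (T B) := by
        refine e.injective ?_
        rw [map_add]
        simp only [χ, e.apply_symm_apply]
        refine Subtype.ext (funext fun x => ?_)
        change (BddFun.indicator R (T E)).1 x = (BddFun.indicator R (T A)).1 x +
          (BddFun.indicator R (T B)).1 x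
        have hEx : x ∈ T E ↔ x ∈ T A ∨ x ∈ T B := hE x.1
        have hABx : ¬ (x ∈ T A ∧ x ∈ T B) := hAB x.1
        by_cases hA : x ∈ T A <;> by_cases hB : x ∈ T B
        · exact (hABx ⟨hA, hB⟩).elim
        · rw [BddFun.indicator_of_mem hA, BddFun.indicator_of_notMem hB,
            BddFun.indicator_of_mem (hEx.2 (Or.inl hA)), add_zero]
        · rw [BddFun.indicator_of_notMem hA, BddFun.indicator_of_mem hB,
            BddFun.indicator_of_mem (hEx.2 (Or.inr hB)), zero_add]
        · rw [BddFun.indicator_of_notMem hA, BddFun.indicator_of_notMem hB,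
            BddFun.indicator_of_notMem fun h => (hEx.1 h).elim hA hB, add_zero]
      have hφ : φ.toFun (χ (T E)) = φ.toFun (χ (T A)) + φ.toFun (χ (T B)) := by
        rw [hsum, map_add]
      rcases h01 (T A) with hA | hA <;> rcases h01 (T B) with hB | hB <;> rw [hA, hB] at hφ
      · simp [μ, hA, hB, hφ]
      · simp [μ, hA, hB, hφ]
      · simp [μ, hA, hB, hφ]
      -- Two disjoint sets cannot both have value 1, as their union would have value 2.
      · rcases h01 (T E) with hE | hE <;> rw [hE] at hφ <;> exfalso <;> linarith
    · rw [(μ1 A).2 (h1 _ (Or.inl (by rwa [code_T])))]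
      exact one_pos

end Backward
end ZFModel

/-- Over `ZF`, the Banach-Alaoglu theorem and `BPI` are equivalent: every model of `ZF` that
satisfies one of them satisfies the other. -/
theorem mainTheorem3 (M : Type u) [ZFModel.setLang.Structure M] [ZFModel.IsZFModel M] :
    ZFModel.BanachAlaoglu M ↔ ZFModel.BPI M :=
  ⟨ZFModel.BanachAlaoglu.bpi, ZFModel.BPI.banachAlaoglu⟩
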